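/- Let $R$ be a commutative integral domain with identity, equipped with an involution $r\mapsto r^*$ that is a ring automorphism (possibly the identity), and let $\Gamma$ be a discrete group with identity $e$. For $i=1,2$ let $\mathcal G_i$ be an ample Hausdorff groupoid, with range and source maps $r,s:\mathcal G_i\to\mathcal G_i^0$. That is, $\mathcal G_i$ is a groupoid (a small category with inverses, identified with its set of morphisms) with a Hausdorff topology for which inversion and composition are continuous, $r$ and $s$ are local homeomorphisms, and the unit space $\mathcal G_i^0$ has a basis of compact open sets. Let $c_i:\mathcal G_i\to\Gamma$ be a continuous cocycle, i.e. a continuous map with $c_i(\alpha\beta)=c_i(\alpha)c_i(\beta)$ for all composable $\alpha,\beta$. Assume that there is a dense subset $X_i\subseteq\mathcal G_i^0$ such that for every $x\in X_i$ the group ring $RH$ of the group $H=\{\gamma\in\mathcal G_i: r(\gamma)=s(\gamma)=x,\ c_i(\gamma)=e\}$ has no zero-divisors and only trivial units (every unit of $RH$ has the form $uh$ with $u\in R$ and $h\in H$). Let $A_R(\mathcal G_i)$ be the Steinberg algebra of $\mathcal G_i$: the $*$-algebra over $R$ of locally constant functions $f:\mathcal G_i\to R$ with compact support, with pointwise addition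 and scalar multiplication, product $(f*g)(\eta)=\sum_{\alpha\beta=\eta}f(\alpha)g(\beta)$ and involution $f^*(\eta)=f(\eta^{-1})^*$. Let $D_R(\mathcal G_i)=\{f\in A_R(\mathcal G_i): f \text{ vanishes off } \mathcal G_i^0\}$, and for $g\in\Gamma$ let $A_R(\mathcal G_i)_g=\{f\in A_R(\mathcal G_i): f\text{ vanishes off }c_i^{-1}(g)\}$. A bijection $\phi:A_R(\mathcal G_1)\to A_R(\mathcal G_2)$ is called diagonal-preserving if $\phi(D_R(\mathcal G_1))=D_R(\mathcal G_2)$, and graded if $\phi(A_R(\mathcal G_1)_g)=A_R(\mathcal G_2)_g$ for all $g\in\Gamma$. Then the following are equivalent. 1. There is an isomorphism of topological groupoids $\psi:\mathcal G_1\to\mathcal G_2$ (a homeomorphism that carries units to units, preserves range and source, and satisfies $\psi(\alpha\beta)=\psi(\alpha)\psi(\beta)$ for all composable $\alpha,\beta$) such that $c_2\circ\psi=c_1$. 2. There is a diagonal-preserving graded $*$-algebra isomorphism ($R$-linear, multiplicative, $*$-preserving) $A_R(\mathcal G_1)\to A_R(\mathcal G_2)$. 3. There is a diagonal-preserving graded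 ring isomorphism $A_R(\mathcal G_1)\to A_R(\mathcal G_2)$. -/

import Mathlib

namespace SteinbergAlg

open CategoryTheory Topology

universe u v w

/-! ### Topological groupoids

A groupoid is a small category with inverses.  The set `𝒢` of its morphisms is `Arrows X`, where
`X` is the set of objects; an arrow `α` has source `α.left` and range `α.right`, and the product
`αβ` is defined when the source of `α` is the range of `β`. -/

section Groupoids

/-- The set of all morphisms of the groupoid with object set `X`. -/
abbrev Arrows (X : Type u) [Groupoid.{v} X] : Type max u v := Quiver.Total X

variable {X : Type u} [Groupoid.{v} X]

/-- The identity morphism at an object, as an element of the set of all morphisms. -/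
def unit (x : X) : Arrows X := ⟨x, x, 𝟙 x⟩

variable (X) in
/-- The unit space `𝒢⁰`: the set of identity morphisms. -/
def unitSpace : Set (Arrows X) := Set.range unit

/-- The identity morphism at an object, as a point of the unit space. -/
def toUnitSpace (x : X) : unitSpace X := ⟨unit x, x, rfl⟩

/-- The range map `𝒢 → 𝒢⁰`. -/
def rng (α : Arrows X) : unitSpace X := toUnitSpace α.right

/-- The source map `𝒢 → 𝒢⁰`. -/
def src (α : Arrows X) : unitSpace X := toUnitSpace α.left

/-- The inverse map. -/
def inv (α : Arrows X) : Arrows X := ⟨α.right, α.left, Groupoid.inv α.hom⟩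

theorem inv_inv (η : Arrows X) : inv (inv η) = η := by
  simp [inv]

variable (X) in
/-- The set `𝒢²` of composable pairs `(α, β)`, those for which `s(α) = r(β)`. -/
abbrev ComposablePairs : Type max u v :=
  {p : Arrows X × Arrows X // src p.1 = rng p.2}

theorem unit_injective : Function.Injective (unit : X → Arrows X) := fun x y h => by
  simpa [unit] using congrArg Quiver.Total.left h

theorem toUnitSpace_injective : Function.Injective (toUnitSpace : X → unitSpace X) :=
  fun _ _ h => unit_injective (congrArg Subtype.val h)

theorem src_eq_rng_iff (α β : Arrows X) : src α = rng β ↔ α.left = β.right :=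
  toUnitSpace_injective.eq_iff

/-- The product `αβ` of a composable pair `(α, β)`. -/
def comp (p : ComposablePairs X) : Arrows X :=
  ⟨p.1.2.left, p.1.1.right,
    p.1.2.hom ≫ eqToHom ((src_eq_rng_iff p.1.1 p.1.2).1 p.2).symm ≫ p.1.1.hom⟩

/-- The composable pair consisting of two composable morphisms. -/
def mkPair {x y z : X} (a : y ⟶ z) (b : x ⟶ y) : ComposablePairs X :=
  ⟨(⟨y, z, a⟩, ⟨x, y, b⟩), (src_eq_rng_iff _ _).2 rfl⟩

theorem comp_mkPair {x y z : X} (a : y ⟶ z) (b : x ⟶ y) :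
    comp (mkPair a b) = ⟨x, z, b ≫ a⟩ := by
  change (⟨x, z, b ≫ eqToHom (rfl : y = y) ≫ a⟩ : Arrows X) = _
  simp

variable [TopologicalSpace (Arrows X)]

variable (X) in
/-- An ample groupoid: a topology on the set of morphisms for which inversion and composition are
continuous, the range and source maps are local homeomorphisms onto the unit space (with the
subspace topology), and the unit space has a basis of compact open sets. -/
class IsAmple : Prop where
  continuous_inv : Continuous (inv : Arrows X → Arrows X)
  continuous_comp : Continuous (comp : ComposablePairs X → Arrows X)
  isLocalHomeomorph_rng : IsLocalHomeomorph (rng : Arrows X → unitSpace X)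
  isLocalHomeomorph_src : IsLocalHomeomorph (src : Arrows X → unitSpace X)
  isTopologicalBasis :
    TopologicalSpace.IsTopologicalBasis {U : Set (unitSpace X) | IsCompact U ∧ IsOpen U}

variable (X) in
/-- A continuous cocycle on a topological groupoid with values in a (discrete) group `Γ`. -/
structure Cocycle (Γ : Type w) [Group Γ] [TopologicalSpace Γ] where
  toFun : Arrows X → Γ
  continuous_toFun : Continuous toFun
  map_comp : ∀ p : ComposablePairs X, toFun (comp p) = toFun p.1.1 * toFun p.1.2

namespace Cocycle

variable {Γ : Type w} [Group Γ] [TopologicalSpace Γ]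

instance : CoeFun (Cocycle X Γ) (fun _ => Arrows X → Γ) := ⟨Cocycle.toFun⟩

theorem map_loop_mul (c : Cocycle X Γ) (x : X) (a b : End x) :
    c ⟨x, x, a * b⟩ = c ⟨x, x, a⟩ * c ⟨x, x, b⟩ :=
  (congrArg c.toFun (comp_mkPair a b)).symm.trans (c.map_comp (mkPair a b))

/-- For an object `x`, the group `c⁻¹(e) ∩ 𝒢ₓˣ`, a subgroup of the isotropy group at `x`. -/
def kerIsotropy (c : Cocycle X Γ) (x : X) : Subgroup (End x) :=
  (MonoidHom.mk' (fun a : End x => c ⟨x, x, a⟩) (c.map_loop_mul x)).ker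

end Cocycle

/-- Isomorphisms of topological groupoids: homeomorphisms between the sets of morphisms that carry
units to units, preserve the range and source maps, and satisfy `ψ(αβ) = ψ(α)ψ(β)` for all
composable pairs `(α, β)`. -/
structure GroupoidIso (X : Type*) [Groupoid X] [TopologicalSpace (Arrows X)]
    (Y : Type*) [Groupoid Y] [TopologicalSpace (Arrows Y)]
    extends Arrows X ≃ₜ Arrows Y where
  map_unit : ∀ α ∈ unitSpace X, toFun α ∈ unitSpace Y
  map_rng : ∀ α, toFun (rng α : Arrows X) = rng (toFun α)
  map_src : ∀ α, toFun (src α : Arrows X) = src (toFun α)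
  map_comp : ∀ p : ComposablePairs X, ∃ q : ComposablePairs Y,
    q.1 = (toFun p.1.1, toFun p.1.2) ∧ toFun (comp p) = comp q

end Groupoids

/-! ### Group rings -/

/-- Every unit of the group ring `RG` is trivial, that is, of the form `r g` with `r ∈ R` and
`g ∈ G`. -/
def OnlyTrivialUnits (R : Type*) [CommRing R] (G : Type*) [Group G] : Prop :=
  ∀ a : MonoidAlgebra R G, IsUnit a → ∃ (r : R) (g : G), a = MonoidAlgebra.single g r

/-- There is a dense set of units `x` such that the group ring `R(c⁻¹(e) ∩ 𝒢ₓˣ)` has no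
zero-divisors and only trivial units. -/
def IsotropyCondition (R : Type*) [CommRing R] {X : Type*} [Groupoid X]
    [TopologicalSpace (Arrows X)] {Γ : Type*} [Group Γ] [TopologicalSpace Γ]
    (c : Cocycle X Γ) : Prop :=
  ∃ D : Set (unitSpace X), Dense D ∧ ∀ x : X, toUnitSpace x ∈ D →
    NoZeroDivisors (MonoidAlgebra R (c.kerIsotropy x)) ∧ OnlyTrivialUnits R (c.kerIsotropy x)

/-! ### Steinberg algebras -/

section Algebra

variable {R : Type w} [CommRing R] {X : Type u} [Groupoid.{v} X]

section Topology

variable [TopologicalSpace (Arrows X)]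

theorem isClopen_support {f : Arrows X → R} (hf : IsLocallyConstant f) :
    IsClopen (Function.support f) :=
  (hf.isClopen_fiber 0).compl

variable (R X) in
/-- The `R`-module of locally constant `R`-valued functions with compact support on the set of
morphisms of a topological groupoid, with pointwise operations. -/
def steinbergSubmodule : Submodule R (Arrows X → R) where
  carrier := {f | IsLocallyConstant f ∧ IsCompact (Function.support f)}
  zero_mem' := ⟨IsLocallyConstant.const 0, by simp⟩
  add_mem' := fun {f g} hf hg => ⟨hf.1.add hg.1,
    (hf.2.union hg.2).of_isClosed_subset (isClopen_support (hf.1.add hg.1)).1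
      (Function.support_add f g)⟩
  smul_mem' := fun r f hf => ⟨hf.1.comp (r • ·),
    hf.2.of_isClosed_subset (isClopen_support (hf.1.comp (r • ·))).1
      (Function.support_const_smul_subset r f)⟩

end Topology

/-- The convolution product `(f * g)(η) = ∑_{αβ = η} f(α) g(β)`. -/
noncomputable def conv (f g : Arrows X → R) (η : Arrows X) : R :=
  ∑ᶠ p : {p : ComposablePairs X // comp p = η}, f p.1.1.1 * g p.1.1.2

/-- The pairs with product `η` are parametrised by their first component. -/
noncomputable def factorEquiv {x y : X} (h : x ⟶ y) :
    (Σ z : X, (z ⟶ y)) ≃ {p : ComposablePairs X // comp p = ⟨x, y, h⟩} :=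
  Equiv.ofBijective
    (fun a => ⟨mkPair a.2 (h ≫ Groupoid.inv a.2), by rw [comp_mkPair]; simp⟩) <| by
    constructor
    · rintro ⟨z, a⟩ ⟨z', a'⟩ he
      have := congrArg (fun p => p.1.1.1) he
      simp only [mkPair] at this
      cases this
      rfl
    · rintro ⟨⟨⟨⟨z, y', a⟩, ⟨x', z', b⟩⟩, h1⟩, h2⟩
      obtain rfl : z = z' := (src_eq_rng_iff _ _).1 h1
      cases h2.symm.trans (comp_mkPair a b)
      refine ⟨⟨z, a⟩, Subtype.ext (Subtype.ext ?_)⟩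
      simp [mkPair]

theorem conv_mk (f g : Arrows X → R) {x y : X} (h : x ⟶ y) :
    conv f g ⟨x, y, h⟩ =
      ∑ᶠ a : Σ z : X, (z ⟶ y), f ⟨a.1, y, a.2⟩ * g ⟨x, a.1, h ≫ Groupoid.inv a.2⟩ :=
  (finsum_comp_equiv (factorEquiv h)).symm

/-- If the range map is injective on the support of `f`, there is at most one summand. -/
theorem conv_of_mem {f : Arrows X → R} (hf : Set.InjOn rng (Function.support f))
    (g : Arrows X → R) {x y z : X} (h : x ⟶ y) (b : z ⟶ y)
    (hb : (⟨z, y, b⟩ : Arrows X) ∈ Function.support f) :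
    conv f g ⟨x, y, h⟩ = f ⟨z, y, b⟩ * g ⟨x, z, h ≫ Groupoid.inv b⟩ := by
  rw [conv_mk, finsum_eq_single _ ⟨z, b⟩]
  rintro ⟨z', b'⟩ hne
  by_cases h0 : f ⟨z', y, b'⟩ = 0
  · simp [h0]
  · have := hf (x₁ := ⟨z', y, b'⟩) (x₂ := ⟨z, y, b⟩) h0 hb rfl
    cases this
    exact absurd rfl hne

theorem conv_of_notMem (f g : Arrows X → R) {x y : X} (h : x ⟶ y)
    (hb : ∀ (z : X) (b : z ⟶ y), f ⟨z, y, b⟩ = 0) : conv f g ⟨x, y, h⟩ = 0 := by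
  rw [conv_mk]
  simp [hb]

theorem conv_ne_zero {f g : Arrows X → R} {η : Arrows X} (h : conv f g η ≠ 0) :
    ∃ p : ComposablePairs X, comp p = η ∧ f p.1.1 ≠ 0 ∧ g p.1.2 ≠ 0 := by
  obtain ⟨p, hp⟩ : ∃ p : {p : ComposablePairs X // comp p = η}, f p.1.1.1 * g p.1.1.2 ≠ 0 := by
    by_contra! H
    exact h (by simp [conv, H])
  exact ⟨p.1, p.2, left_ne_zero_of_mul hp, right_ne_zero_of_mul hp⟩

variable [TopologicalSpace (Arrows X)]

variable (R X) in
/-- The underlying type of the Steinberg algebra `A_R(𝒢)`. -/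
abbrev SteinbergAlgebra : Type max u v w := steinbergSubmodule R X

namespace SteinbergAlgebra

instance : CoeFun (SteinbergAlgebra R X) (fun _ => Arrows X → R) := ⟨fun f => f.1⟩

@[ext] theorem ext {f g : SteinbergAlgebra R X} (h : ∀ η, f η = g η) : f = g :=
  Subtype.ext (funext h)

theorem add_apply (f g : SteinbergAlgebra R X) (η : Arrows X) : (f + g) η = f η + g η := rfl

theorem smul_apply (r : R) (f : SteinbergAlgebra R X) (η : Arrows X) : (r • f) η = r * f η := rfl

theorem zero_apply (η : Arrows X) : (0 : SteinbergAlgebra R X) η = 0 := rfl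

theorem isLocallyConstant (f : SteinbergAlgebra R X) : IsLocallyConstant f := f.2.1

theorem isCompact_support (f : SteinbergAlgebra R X) : IsCompact (Function.support f) := f.2.2

end SteinbergAlgebra

section Ample

set_option linter.unusedSectionVars false

variable [IsAmple X] [T2Space (Arrows X)]

theorem exists_bisection (η : Arrows X) :
    ∃ U : Set (Arrows X), η ∈ U ∧ IsCompact U ∧ IsOpen U ∧ U.InjOn rng ∧ U.InjOn src := by
  obtain ⟨e, he, hr⟩ := IsAmple.isLocalHomeomorph_rng η
  obtain ⟨e', he', hs⟩ := IsAmple.isLocalHomeomorph_src η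
  have hopen : IsOpen (e '' (e.source ∩ e'.source)) :=
    e.isOpen_image_of_subset_source (e.open_source.inter e'.open_source) Set.inter_subset_left
  obtain ⟨K, ⟨hKc, hKo⟩, hK, hKs⟩ :=
    (IsAmple.isTopologicalBasis (X := X)).exists_subset_of_mem_open
      (Set.mem_image_of_mem e (Set.mem_inter he he')) hopen
  have hKt : K ⊆ e.target := fun k hk => by
    obtain ⟨a, ha, rfl⟩ := hKs hk
    exact e.map_source ha.1
  have hsub : e.symm '' K ⊆ e.source ∩ e'.source := by
    rintro _ ⟨k, hk, rfl⟩
    obtain ⟨a, ha, rfl⟩ := hKs hk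
    rwa [e.left_inv ha.1]
  refine ⟨e.symm '' K, ⟨e η, hK, e.left_inv he⟩,
    hKc.image_of_continuousOn (e.continuousOn_symm.mono hKt),
    e.symm.isOpen_image_of_subset_source hKo hKt, ?_, ?_⟩
  · rw [hr]
    exact e.injOn.mono fun a ha => (hsub ha).1
  · rw [hs]
    exact e'.injOn.mono fun a ha => (hsub ha).2

/-- Every element of the Steinberg algebra is a sum of elements supported on bisections. -/
theorem SteinbergAlgebra.induction {P : SteinbergAlgebra R X → Prop} (h0 : P 0)
    (hadd : ∀ f g, P f → P g → P (f + g))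
    (hbis : ∀ f : SteinbergAlgebra R X, Set.InjOn rng (Function.support f) →
      Set.InjOn src (Function.support f) → P f)
    (f : SteinbergAlgebra R X) : P f := by
  classical
  choose U hU hUc hUo hUr hUs using exists_bisection (X := X)
  obtain ⟨t, ht⟩ := f.isCompact_support.elim_finite_subcover U hUo
    (fun η _ => Set.mem_iUnion.2 ⟨η, hU η⟩)
  induction t using Finset.induction_on generalizing f with
  | empty =>
    have : f = 0 := by
      ext η
      by_contra h
      simpa using ht h
    rwa [this]
  | insert a t _ ih =>
    have key : ∀ V : Set (Arrows X), IsClopen V →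
        ∃ g : SteinbergAlgebra R X, ∀ η, g η = if η ∈ V then f η else 0 := fun V hV => by
      have hl : IsLocallyConstant (fun η => if η ∈ V then f η else 0) := by
        rw [IsLocallyConstant.iff_eventually_eq]
        intro η
        by_cases h : η ∈ V
        · filter_upwards [f.isLocallyConstant.eventually_eq η, hV.2.mem_nhds h] with ζ h1 h2
          simp [h, h1, h2]
        · filter_upwards [hV.compl.2.mem_nhds h] with ζ h2
          simp [h, show ζ ∉ V from h2]
      exact ⟨⟨_, hl, f.isCompact_support.of_isClosed_subset (isClopen_support hl).1
        fun η h => by by_contra h'; simp_all⟩, fun _ => rfl⟩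
    have hcl : IsClopen (U a) := ⟨(hUc a).isClosed, hUo a⟩
    obtain ⟨g₁, hg₁⟩ := key _ hcl
    obtain ⟨g₂, hg₂⟩ := key _ hcl.compl
    have hs : Function.support g₁ ⊆ U a := fun η h => by
      by_contra h'
      exact h (by simp [hg₁, h'])
    have : f = g₁ + g₂ := by
      ext η
      rw [SteinbergAlgebra.add_apply, hg₁, hg₂]
      by_cases h : η ∈ U a <;> simp [h]
    rw [this]
    refine hadd _ _ (hbis _ ((hUr a).mono hs) ((hUs a).mono hs)) (ih _ fun η h => ?_)
    have h1 : η ∉ U a := fun h' => h (by simp [hg₂, h'])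
    have h2 : f η ≠ 0 := fun h' => h (by simp [hg₂, h'])
    simpa [h1] using ht h2

theorem finite_support_fiber (f : SteinbergAlgebra R X) (y : X) :
    {a : Σ z : X, (z ⟶ y) | f ⟨a.1, y, a.2⟩ ≠ 0}.Finite := by
  induction f using SteinbergAlgebra.induction with
  | h0 => simp [SteinbergAlgebra.zero_apply]
  | hadd f g hf hg =>
    refine (hf.union hg).subset fun a ha => ?_
    by_contra h
    simp only [Set.mem_union, Set.mem_ofPred_eq, not_or, not_not] at h
    exact ha (by simp [SteinbergAlgebra.add_apply, h])
  | hbis f hr _ =>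
    refine Set.Subsingleton.finite ?_
    rintro ⟨z, a⟩ ha ⟨z', a'⟩ ha'
    have := hr (x₁ := ⟨z, y, a⟩) (x₂ := ⟨z', y, a'⟩) ha ha' rfl
    cases this
    rfl

theorem finite_support_conv (f : SteinbergAlgebra R X) (g : Arrows X → R) {x y : X} (h : x ⟶ y) :
    Function.HasFiniteSupport fun a : Σ z : X, (z ⟶ y) =>
      f ⟨a.1, y, a.2⟩ * g ⟨x, a.1, h ≫ Groupoid.inv a.2⟩ :=
  (finite_support_fiber f y).subset fun _ ha => left_ne_zero_of_mul ha

theorem conv_add_left (f f' : SteinbergAlgebra R X) (g : Arrows X → R) :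
    conv (f + f' : SteinbergAlgebra R X) g = conv f g + conv f' g := by
  funext ⟨x, y, h⟩
  simp only [Pi.add_apply, conv_mk]
  rw [← finsum_add_distrib (finite_support_conv f g h) (finite_support_conv f' g h)]
  simp only [SteinbergAlgebra.add_apply, add_mul]

theorem conv_add_right (f g g' : SteinbergAlgebra R X) :
    conv f (g + g' : SteinbergAlgebra R X) = conv f g + conv f g' := by
  funext ⟨x, y, h⟩
  simp only [Pi.add_apply, conv_mk]
  rw [← finsum_add_distrib (finite_support_conv f g h) (finite_support_conv f g' h)]
  simp only [SteinbergAlgebra.add_apply, mul_add]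

theorem isLocallyConstant_conv (f g : SteinbergAlgebra R X) : IsLocallyConstant (conv f g) := by
  induction f using SteinbergAlgebra.induction with
  | h0 =>
    have : conv (0 : SteinbergAlgebra R X) g = 0 := by
      funext ⟨x, y, h⟩
      exact conv_of_notMem _ _ _ fun _ _ => rfl
    rw [this]
    exact IsLocallyConstant.const 0
  | hadd f f' hf hf' =>
    rw [conv_add_left]
    exact hf.add hf'
  | hbis f hr _ =>
    have hrc : Continuous (rng : Arrows X → unitSpace X) := IsAmple.isLocalHomeomorph_rng.continuous
    rw [IsLocallyConstant.iff_eventually_eq]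
    rintro ⟨x, y, h⟩
    by_cases hy : ∃ (z : X) (b : z ⟶ y), f ⟨z, y, b⟩ ≠ 0
    · obtain ⟨z, b, hb⟩ := hy
      obtain ⟨e, he, her⟩ := IsAmple.isLocalHomeomorph_rng (⟨z, y, b⟩ : Arrows X)
      have hrr : ∀ k ∈ e.target, rng (e.symm k) = k := fun k hk => by
        rw [her]; exact e.right_inv hk
      have hy : e ⟨z, y, b⟩ = toUnitSpace y := by rw [← her]; rfl
      have hyt : toUnitSpace y ∈ e.target := hy ▸ e.map_source he
      have hey : e.symm (toUnitSpace y) = ⟨z, y, b⟩ := by rw [← hy]; exact e.left_inv he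
      let V : Set (Arrows X) := rng ⁻¹' e.target
      have hV : IsOpen V := e.open_target.preimage hrc
      let F : V → ComposablePairs X := fun η => ⟨(inv (e.symm (rng η.1)), η.1), hrr _ η.2⟩
      have hsym : Continuous fun η : V => e.symm (rng η.1) :=
        e.continuousOn_symm.comp_continuous (hrc.comp continuous_subtype_val) fun η => η.2
      have hF : Continuous F :=
        ((IsAmple.continuous_inv.comp hsym).prodMk continuous_subtype_val).subtype_mk _
      let η₀ : V := ⟨⟨x, y, h⟩, hyt⟩
      have h1 := (f.isLocallyConstant.comp_continuous hsym).eventually_eq η₀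
      have h2 := (g.isLocallyConstant.comp_continuous
        (IsAmple.continuous_comp.comp hF)).eventually_eq η₀
      have h3 : ∀ η : V, f (e.symm (rng η.1)) ≠ 0 →
          conv f g η.1 = f (e.symm (rng η.1)) * g (comp (F η)) := by
        rintro ⟨⟨x', y', h'⟩, hη⟩ hne
        have hr' := hrr _ hη
        have aux : ∀ (β : Arrows X) (hβ : rng β = rng (⟨x', y', h'⟩ : Arrows X)), f β ≠ 0 →
            conv f g ⟨x', y', h'⟩ = f β * g (comp ⟨(inv β, ⟨x', y', h'⟩), hβ⟩) := by
          clear hne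
          rintro ⟨z', y'', b'⟩ hβ hne
          obtain rfl : y'' = y' := toUnitSpace_injective hβ
          rw [conv_of_mem hr g h' b' hne]
          exact congrArg (fun t => f _ * g t) (comp_mkPair (Groupoid.inv b') h').symm
        exact aux _ hr' hne
      have h4 : ∀ᶠ η : V in 𝓝 η₀, conv f g η.1 = conv f g η₀.1 := by
        have hne0 : f (e.symm (rng η₀.1)) ≠ 0 := by
          have : e.symm (rng η₀.1) = ⟨z, y, b⟩ := hey
          rw [this]; exact hb
        filter_upwards [h1, h2] with η h1 h2
        simp only [Function.comp_apply] at h1 h2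
        rw [h3 η (h1 ▸ hne0), h3 η₀ hne0, h1, h2]
      have h5 := Filter.eventually_comap.1 ((nhds_subtype_eq_comap (x := η₀.1) (h := η₀.2)) ▸ h4)
      filter_upwards [h5, hV.mem_nhds η₀.2] with η h6 h7
      exact h6 ⟨η, h7⟩ rfl
    · push Not at hy
      have hcl : IsClosed (rng '' Function.support f) :=
        (f.isCompact_support.image hrc).isClosed
      have hn : rng (⟨x, y, h⟩ : Arrows X) ∉ rng '' Function.support f := by
        rintro ⟨⟨z, y', b⟩, hb, hb'⟩
        obtain rfl : y' = y := toUnitSpace_injective hb'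
        exact hb (hy z b)
      filter_upwards [(hcl.isOpen_compl.preimage hrc).mem_nhds hn] with η hη
      obtain ⟨x', y', h'⟩ := η
      rw [conv_of_notMem f g h hy, conv_of_notMem f g h']
      intro z b
      by_contra hb
      exact hη ⟨_, hb, rfl⟩

theorem conv_mem (f g : SteinbergAlgebra R X) : conv f g ∈ steinbergSubmodule R X := by
  refine ⟨isLocallyConstant_conv f g, ?_⟩
  have hcl : IsClosed {p : Arrows X × Arrows X | src p.1 = rng p.2} :=
    isClosed_eq (IsAmple.isLocalHomeomorph_src.continuous.comp continuous_fst)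
      (IsAmple.isLocalHomeomorph_rng.continuous.comp continuous_snd)
  have hK := (hcl.isClosedEmbedding_subtypeVal.isCompact_preimage
    (f.isCompact_support.prod g.isCompact_support)).image (IsAmple.continuous_comp (X := X))
  refine hK.of_isClosed_subset (isClopen_support (isLocallyConstant_conv f g)).1 fun η hη => ?_
  obtain ⟨p, rfl, h1, h2⟩ := conv_ne_zero hη
  exact ⟨p, ⟨h1, h2⟩, rfl⟩

namespace SteinbergAlgebra

noncomputable instance : Mul (SteinbergAlgebra R X) := ⟨fun f g => ⟨conv f g, conv_mem f g⟩⟩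

theorem mul_apply (f g : SteinbergAlgebra R X) (η : Arrows X) : (f * g) η = conv f g η := rfl

theorem add_mul' (f f' g : SteinbergAlgebra R X) : (f + f') * g = f * g + f' * g :=
  Subtype.ext (conv_add_left f f' g)

theorem mul_add' (f g g' : SteinbergAlgebra R X) : f * (g + g') = f * g + f * g' :=
  Subtype.ext (conv_add_right f g g')

theorem zero_mul' (g : SteinbergAlgebra R X) : 0 * g = 0 := by
  simpa using add_mul' 0 0 g

theorem mul_zero' (g : SteinbergAlgebra R X) : g * 0 = 0 := by
  simpa using mul_add' g 0 0

theorem mul_assoc' (f g k : SteinbergAlgebra R X) : f * g * k = f * (g * k) := by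
  induction f using SteinbergAlgebra.induction with
  | h0 => simp only [zero_mul']
  | hadd f f' hf hf' => simp only [add_mul', hf, hf']
  | hbis f hr _ =>
    ext ⟨x, y, h⟩
    by_cases hy : ∃ (z : X) (b : z ⟶ y), f ⟨z, y, b⟩ ≠ 0
    · obtain ⟨z, b, hb⟩ := hy
      rw [mul_apply, mul_apply, conv_of_mem hr _ h b hb, mul_apply, conv_mk, conv_mk,
        mul_finsum' _ _ (finite_support_conv g k _)]
      let e : (Σ w : X, (w ⟶ z)) ≃ (Σ w : X, (w ⟶ y)) :=
        { toFun := fun a => ⟨a.1, a.2 ≫ b⟩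
          invFun := fun a => ⟨a.1, a.2 ≫ Groupoid.inv b⟩
          left_inv := fun a => by simp
          right_inv := fun a => by simp }
      rw [← finsum_comp_equiv e]
      refine finsum_congr fun a => ?_
      simp only [e]
      rw [mul_apply, conv_of_mem hr _ _ b hb, mul_assoc]
      simp
    · push Not at hy
      rw [mul_apply, mul_apply, conv_of_notMem f _ h hy, conv_of_notMem]
      intro z b
      exact conv_of_notMem f g b hy

noncomputable instance : NonUnitalRing (SteinbergAlgebra R X) :=
  { (inferInstance : AddCommGroup (SteinbergAlgebra R X)) with
    mul := (· * ·)
    left_distrib := mul_add'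
    right_distrib := add_mul'
    zero_mul := zero_mul'
    mul_zero := mul_zero'
    mul_assoc := mul_assoc' }

instance : IsScalarTower R (SteinbergAlgebra R X) (SteinbergAlgebra R X) where
  smul_assoc r f g := by
    ext ⟨x, y, h⟩
    rw [smul_eq_mul, smul_eq_mul, mul_apply, smul_apply, mul_apply, conv_mk, conv_mk,
      mul_finsum' _ _ (finite_support_conv f g h)]
    simp only [smul_apply, mul_assoc]

instance : SMulCommClass R (SteinbergAlgebra R X) (SteinbergAlgebra R X) where
  smul_comm r f g := by
    ext ⟨x, y, h⟩
    rw [smul_eq_mul, smul_eq_mul, mul_apply, smul_apply, mul_apply, conv_mk, conv_mk,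
      mul_finsum' _ _ (finite_support_conv f g h)]
    simp only [smul_apply, mul_left_comm]

theorem star_mem [StarRing R] (f : SteinbergAlgebra R X) :
    (fun η => star (f (inv η))) ∈ steinbergSubmodule R X := by
  have hl : IsLocallyConstant fun η => star (f (inv η)) :=
    (f.isLocallyConstant.comp_continuous IsAmple.continuous_inv).comp star
  refine ⟨hl, (f.isCompact_support.image IsAmple.continuous_inv).of_isClosed_subset
    (isClopen_support hl).1 fun η hη => ⟨inv η, fun h => hη ?_, inv_inv η⟩⟩
  simp [h]

/-- The involution `f*(η) = f(η⁻¹)*`. -/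
instance [StarRing R] : Star (SteinbergAlgebra R X) :=
  ⟨fun f => ⟨fun η => star (f (inv η)), star_mem f⟩⟩

theorem star_apply [StarRing R] (f : SteinbergAlgebra R X) (η : Arrows X) :
    (star f) η = star (f (inv η)) := rfl

instance [StarRing R] : StarRing (SteinbergAlgebra R X) where
  star_involutive f := by
    ext η
    simp [star_apply, inv_inv]
  star_add f g := by
    ext η
    simp [star_apply, add_apply]
  star_mul f g := by
    ext ⟨x, y, h⟩
    rw [star_apply, mul_apply, mul_apply]
    simp only [inv]
    rw [conv_mk, conv_mk]
    let e : (Σ w : X, (w ⟶ x)) ≃ (Σ w : X, (w ⟶ y)) :=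
      { toFun := fun a => ⟨a.1, a.2 ≫ h⟩
        invFun := fun a => ⟨a.1, a.2 ≫ Groupoid.inv h⟩
        left_inv := fun a => by simp
        right_inv := fun a => by simp }
    rw [← finsum_comp_equiv e]
    rw [show (star : R → R) = (starAddEquiv : R ≃+ R).toAddMonoidHom from rfl,
      AddMonoidHom.map_finsum _ (finite_support_conv f g _)]
    refine finsum_congr fun a => ?_
    simp [e, star_apply, inv, mul_comm]

instance [StarRing R] : StarModule R (SteinbergAlgebra R X) where
  star_smul r f := by
    ext η
    simp [star_apply, smul_apply]

end SteinbergAlgebra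

end Ample

variable (R X) in
/-- The diagonal `D_R(𝒢)`: the elements of `A_R(𝒢)` that vanish off the unit space, that is, the
extensions by zero of the locally constant compactly supported functions on `𝒢⁰`. -/
def diagonal : Submodule R (SteinbergAlgebra R X) where
  carrier := {f | Function.support f ⊆ unitSpace X}
  zero_mem' := fun _ h => absurd rfl h
  add_mem' := fun {f g} hf hg =>
    (Function.support_add f.1 g.1).trans (Set.union_subset hf hg)
  smul_mem' := fun r f hf => (Function.support_const_smul_subset r f.1).trans hf

variable (R) in
/-- The homogeneous component `A_R(𝒢)_g` of the grading induced by a cocycle: the elements of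
`A_R(𝒢)` supported on `c⁻¹(g)`. -/
def homogeneous {Γ : Type*} [Group Γ] [TopologicalSpace Γ] (c : Cocycle X Γ) (g : Γ) :
    Submodule R (SteinbergAlgebra R X) where
  carrier := {f | Function.support f ⊆ c ⁻¹' {g}}
  zero_mem' := fun _ h => absurd rfl h
  add_mem' := fun {f g} hf hg =>
    (Function.support_add f.1 g.1).trans (Set.union_subset hf hg)
  smul_mem' := fun r f hf => (Function.support_const_smul_subset r f.1).trans hf

end Algebra

section Maps

variable {R : Type*} [CommRing R] {X : Type*} [Groupoid X] [TopologicalSpace (Arrows X)]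
  {Y : Type*} [Groupoid Y] [TopologicalSpace (Arrows Y)]

/-- `φ(D_R(𝒢₁)) = D_R(𝒢₂)`. -/
def IsDiagonalPreserving (φ : SteinbergAlgebra R X → SteinbergAlgebra R Y) : Prop :=
  φ '' (diagonal R X : Set (SteinbergAlgebra R X)) = diagonal R Y

/-- `φ(A_R(𝒢₁)_g) = A_R(𝒢₂)_g` for all `g ∈ Γ`. -/
def IsGraded {Γ : Type*} [Group Γ] [TopologicalSpace Γ] (c₁ : Cocycle X Γ) (c₂ : Cocycle Y Γ)
    (φ : SteinbergAlgebra R X → SteinbergAlgebra R Y) : Prop :=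
  ∀ g : Γ, φ '' (homogeneous R c₁ g : Set (SteinbergAlgebra R X)) = homogeneous R c₂ g

end Maps

end SteinbergAlg

/-!
An isomorphism of groupoids transports functions, and forgetting the scalars and the involution
turns a `*`-isomorphism into a ring isomorphism; the content is that the ring `A_R(𝒢)`, together
with its diagonal `D` and its grading, determines `𝒢` and the cocycle.

The groupoid is recovered from the homogeneous normalizers of the diagonal: the elements `m` that
have a generalised inverse `n` of the opposite degree with `m D n ⊆ D` and `n D m ⊆ D`
(`IsNormalizerPair`). This notion is preserved by diagonal-preserving graded ring isomorphisms, and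
characteristic functions of homogeneous compact open bisections are examples, so that the supports
of normalizers form a basis of the topology. The hypothesis on isotropy is used to see that,
conversely, the support of every normalizer is a bisection. Let `H` be the group
`c⁻¹(e) ∩ 𝒢ₓˣ`. On the arrows with source `x`, `m` and `n` act by matrices over `RH` (`entry`),
and `m D n ⊆ D` says that a product of an entry of `m` and an entry of `n` vanishes off the
diagonal. Without zero-divisors in `RH`, the column of `m` at `x` has at most one nonzero entry
(`IsNormalizerPair.right_eq_of_left_eq`); this entry is a unit since `n m = 1` at `x`, and as it
is then a multiple of a single element of `H`, there is at most one arrow with source `x` in the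
support of `m` (`IsNormalizerPair.eq_of_left_eq`). By density of the points `x` and the Hausdorff
property, the source map is injective on the support of `m` (`IsNormalizerPair.injOn_src`);
exchanging `m` and `n` gives the same for the range map.

Consequently, an element supported in the support of a normalizer `m` is a diagonal multiple of
`m`, so an isomorphism `φ` as in the third assertion preserves inclusions between supports of
normalizers (`IsNormalizer.support_map_subset`). Each arrow `γ` is then matched with the unique
arrow `δ` such that `m(γ) ≠ 0` if and only if `φ(m)(δ) ≠ 0` for all normalizers `m`: existence
follows from compactness (`exists_corresponds`), uniqueness from the Hausdorff property
(`Corresponds.right_unique`). Supports of normalizers multiply as sets, because `R` is a domain,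
which makes the matching multiplicative (`Corresponds.mul`).
-/

namespace SteinbergAlg

open CategoryTheory Topology

universe u v w

/-! ### Cocycles and supports -/

section Basic

variable {R : Type w} [CommRing R] {X : Type u} [Groupoid.{v} X]

theorem mk_mem_unitSpace_iff {x y : X} {h : x ⟶ y} :
    (⟨x, y, h⟩ : Arrows X) ∈ unitSpace X ↔ (⟨x, y, h⟩ : Arrows X) = ⟨x, x, 𝟙 x⟩ := by
  constructor
  · rintro ⟨z, hz⟩
    cases hz
    rfl
  · intro h
    exact ⟨x, h.symm⟩

section Cocycle

variable [TopologicalSpace (Arrows X)] {Γ : Type*} [Group Γ] [TopologicalSpace Γ]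
  (c : Cocycle X Γ)

theorem Cocycle.map_hom_comp {x y z : X} (b : x ⟶ y) (a : y ⟶ z) :
    c ⟨x, z, b ≫ a⟩ = c ⟨y, z, a⟩ * c ⟨x, y, b⟩ := by
  rw [← comp_mkPair a b]
  exact c.map_comp (mkPair a b)

theorem Cocycle.map_id (x : X) : c ⟨x, x, 𝟙 x⟩ = 1 := by
  have := c.map_hom_comp (𝟙 x) (𝟙 x)
  rw [Category.comp_id] at this
  exact left_eq_mul.1 this

theorem Cocycle.map_hom_inv {x y : X} (a : x ⟶ y) :
    c ⟨y, x, Groupoid.inv a⟩ = (c ⟨x, y, a⟩)⁻¹ := by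
  rw [eq_inv_iff_mul_eq_one, ← c.map_hom_comp, Groupoid.comp_inv, c.map_id]

theorem Cocycle.map_inv (η : Arrows X) : c (inv η) = (c η)⁻¹ := c.map_hom_inv η.hom

theorem Cocycle.mem_kerIsotropy {x : X} {a : End x} :
    a ∈ c.kerIsotropy x ↔ c ⟨x, x, a⟩ = 1 := Iff.rfl

end Cocycle

variable [TopologicalSpace (Arrows X)] [IsAmple X] [T2Space (Arrows X)]

namespace SteinbergAlgebra

/-- A nonzero value of a convolution product at `η` comes from a factorisation of `η`. -/
theorem exists_of_mul_ne_zero {f g : SteinbergAlgebra R X} {x y : X} {h : x ⟶ y}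
    (hne : (f * g) ⟨x, y, h⟩ ≠ 0) :
    ∃ (z : X) (b : x ⟶ z) (a : z ⟶ y), b ≫ a = h ∧ f ⟨z, y, a⟩ ≠ 0 ∧ g ⟨x, z, b⟩ ≠ 0 := by
  rw [mul_apply, conv_mk] at hne
  obtain ⟨⟨z, a⟩, ha⟩ : ∃ a : Σ z : X, (z ⟶ y),
      f ⟨a.1, y, a.2⟩ * g ⟨x, a.1, h ≫ Groupoid.inv a.2⟩ ≠ 0 := by
    by_contra! H
    exact hne (finsum_eq_zero_of_forall_eq_zero H)
  exact ⟨z, h ≫ Groupoid.inv a, a, by simp, left_ne_zero_of_mul ha, right_ne_zero_of_mul ha⟩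

theorem mul_apply_comp {f : SteinbergAlgebra R X} (hf : Set.InjOn rng (Function.support f))
    (g : SteinbergAlgebra R X) {x y z : X} (b : x ⟶ y) (a : y ⟶ z)
    (ha : f ⟨y, z, a⟩ ≠ 0) :
    (f * g) ⟨x, z, b ≫ a⟩ = f ⟨y, z, a⟩ * g ⟨x, y, b⟩ := by
  rw [mul_apply, conv_of_mem hf g (b ≫ a) a ha]
  simp

theorem mul_diagonal_apply (f : SteinbergAlgebra R X) {d : SteinbergAlgebra R X}
    (hd : d ∈ diagonal R X) {x y : X} (h : x ⟶ y) :
    (f * d) ⟨x, y, h⟩ = f ⟨x, y, h⟩ * d (unit x) := by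
  rw [mul_apply, conv_mk, finsum_eq_single _ ⟨x, h⟩]
  · simp [unit]
  · rintro ⟨z, a⟩ hne
    by_contra h0
    have h1 := mk_mem_unitSpace_iff.1 (hd (right_ne_zero_of_mul h0))
    simp only [Quiver.Total.mk.injEq] at h1
    obtain ⟨-, rfl, h2⟩ := h1
    refine hne ?_
    have h3 : h ≫ Groupoid.inv a = 𝟙 z := by simpa using h2
    have : h = a := by simpa using congrArg (· ≫ a) h3
    rw [this]

theorem diagonal_mul_apply {d : SteinbergAlgebra R X} (hd : d ∈ diagonal R X)
    (f : SteinbergAlgebra R X) {x y : X} (h : x ⟶ y) :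
    (d * f) ⟨x, y, h⟩ = d (unit y) * f ⟨x, y, h⟩ := by
  rw [mul_apply, conv_mk, finsum_eq_single _ ⟨y, 𝟙 y⟩]
  · simp [unit]
  · rintro ⟨z, a⟩ hne
    by_contra h0
    have h1 := mk_mem_unitSpace_iff.1 (hd (left_ne_zero_of_mul h0))
    simp only [Quiver.Total.mk.injEq, true_and] at h1
    obtain ⟨rfl, h1⟩ := h1
    obtain rfl := eq_of_heq h1
    exact hne rfl

theorem diagonal_mul_mem {d d' : SteinbergAlgebra R X} (hd : d ∈ diagonal R X)
    (hd' : d' ∈ diagonal R X) : d * d' ∈ diagonal R X := by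
  rintro ⟨x, y, h⟩ hne
  rw [Function.mem_support, diagonal_mul_apply hd] at hne
  exact hd' (right_ne_zero_of_mul hne)

theorem diagonal_mul_comm {d d' : SteinbergAlgebra R X} (hd : d ∈ diagonal R X)
    (hd' : d' ∈ diagonal R X) : d * d' = d' * d := by
  ext ⟨x, y, h⟩
  by_cases hu : (⟨x, y, h⟩ : Arrows X) ∈ unitSpace X
  · have := mk_mem_unitSpace_iff.1 hu
    cases this
    rw [diagonal_mul_apply hd, diagonal_mul_apply hd', mul_comm]
    rfl
  · have h1 : (d * d') ⟨x, y, h⟩ = 0 := by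
      by_contra h0
      exact hu (diagonal_mul_mem hd hd' h0)
    have h2 : (d' * d) ⟨x, y, h⟩ = 0 := by
      by_contra h0
      exact hu (diagonal_mul_mem hd' hd h0)
    rw [h1, h2]

end SteinbergAlgebra

end Basic

/-! ### Normalizer pairs -/

section Normalizer

variable {R : Type w} [CommRing R] {X : Type u} [Groupoid.{v} X] [TopologicalSpace (Arrows X)]
  [IsAmple X] [T2Space (Arrows X)] {Γ : Type*} [Group Γ] [TopologicalSpace Γ]

/-- A homogeneous normalizer `m` of the diagonal subalgebra, of degree `g`, together with a
generalised inverse `n` of degree `g⁻¹`. The definition only refers to the ring structure, the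
diagonal and the grading, so that it is transported by diagonal-preserving graded ring
isomorphisms. -/
structure IsNormalizerPair (c : Cocycle X Γ) (g : Γ) (m n : SteinbergAlgebra R X) : Prop where
  left_mem : m ∈ homogeneous R c g
  right_mem : n ∈ homogeneous R c g⁻¹
  mul_mul_left : m * n * m = m
  mul_mul_right : n * m * n = n
  mul_mem : m * n ∈ diagonal R X
  mul_mem' : n * m ∈ diagonal R X
  conj_mem : ∀ d ∈ diagonal R X, m * d * n ∈ diagonal R X
  conj_mem' : ∀ d ∈ diagonal R X, n * d * m ∈ diagonal R X

namespace IsNormalizerPair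

variable {c : Cocycle X Γ} {g : Γ} {m n : SteinbergAlgebra R X}

theorem symm (h : IsNormalizerPair c g m n) : IsNormalizerPair c g⁻¹ n m where
  left_mem := h.right_mem
  right_mem := by rw [_root_.inv_inv]; exact h.left_mem
  mul_mul_left := h.mul_mul_right
  mul_mul_right := h.mul_mul_left
  mul_mem := h.mul_mem'
  mul_mem' := h.mul_mem
  conj_mem := h.conj_mem'
  conj_mem' := h.conj_mem

theorem mul {g' : Γ} {m' n' : SteinbergAlgebra R X} (h : IsNormalizerPair c g m n)
    (h' : IsNormalizerPair c g' m' n') : IsNormalizerPair c (g * g') (m * m') (n' * n) := by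
  have hom : ∀ {g g' : Γ} {f f' : SteinbergAlgebra R X}, f ∈ homogeneous R c g →
      f' ∈ homogeneous R c g' → f * f' ∈ homogeneous R c (g * g') := by
    rintro g g' f f' hf hf' ⟨x, y, a⟩ hne
    obtain ⟨z, b, a, rfl, h1, h2⟩ := SteinbergAlgebra.exists_of_mul_ne_zero hne
    have h1 : c _ = _ := hf h1
    have h2 : c _ = _ := hf' h2
    change c _ = _
    rw [c.map_hom_comp, h1, h2]
  -- The idempotents `n m` and `m' n'` lie in the commutative diagonal.
  have comm := SteinbergAlgebra.diagonal_mul_comm h.mul_mem' h'.mul_mem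
  refine ⟨hom h.left_mem h'.left_mem, ?_, ?_, ?_, ?_, ?_, ?_, ?_⟩
  · rw [mul_inv_rev]
    exact hom h'.right_mem h.right_mem
  · calc m * m' * (n' * n) * (m * m') = m * ((m' * n') * (n * m)) * m' := by
          simp only [mul_assoc]
      _ = (m * n * m) * (m' * n' * m') := by rw [← comm]; simp only [mul_assoc]
      _ = m * m' := by rw [h.mul_mul_left, h'.mul_mul_left]
  · calc n' * n * (m * m') * (n' * n) = n' * ((n * m) * (m' * n')) * n := by
          simp only [mul_assoc]
      _ = (n' * m' * n') * (n * m * n) := by rw [comm]; simp only [mul_assoc]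
      _ = n' * n := by rw [h.mul_mul_right, h'.mul_mul_right]
  · have := h.conj_mem _ h'.mul_mem
    simpa only [mul_assoc] using this
  · have := h'.conj_mem' _ h.mul_mem'
    simpa only [mul_assoc] using this
  · intro d hd
    have := h.conj_mem _ (h'.conj_mem d hd)
    simpa only [mul_assoc] using this
  · intro d hd
    have := h'.conj_mem' _ (h.conj_mem' d hd)
    simpa only [mul_assoc] using this

/-- Over a domain, the idempotent `n m` is `1` at the sources of the support of `m`. -/
theorem mul_apply_unit [IsDomain R] (h : IsNormalizerPair c g m n) {x y : X} {a : x ⟶ y}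
    (ha : m ⟨x, y, a⟩ ≠ 0) : (n * m) (unit x) = 1 := by
  have h1 : (m * (n * m)) ⟨x, y, a⟩ = m ⟨x, y, a⟩ := by rw [← mul_assoc, h.mul_mul_left]
  rw [SteinbergAlgebra.mul_diagonal_apply m h.mul_mem'] at h1
  exact (mul_eq_left₀ ha).1 h1

end IsNormalizerPair

end Normalizer

/-! ### Matrix entries with values in the group ring of the isotropy -/

section Entry

variable {R : Type w} [CommRing R] {X : Type u} [Groupoid.{v} X] [TopologicalSpace (Arrows X)]
  {Γ : Type*} [Group Γ] [TopologicalSpace Γ]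
  (c : Cocycle X Γ)

theorem conj_injective {x y z : X} (σ : x ⟶ y) (τ : x ⟶ z) :
    Function.Injective fun k : c.kerIsotropy x =>
      (⟨z, Groupoid.inv τ ≫ (k.1 : x ⟶ x) ≫ σ⟩ : Σ z : X, (z ⟶ y)) := by
  intro k k' hkk
  simp only [Sigma.mk.injEq, heq_eq_eq, true_and, Groupoid.inv_eq_inv, cancel_epi,
    cancel_mono] at hkk
  exact Subtype.ext hkk

variable [IsAmple X] [T2Space (Arrows X)]

/-- For arrows `σ` and `τ` with source `x`, the element `∑ₕ f(σ h τ⁻¹) h` of the group ring of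
`c⁻¹(e) ∩ 𝒢ₓˣ`. As `σ` and `τ` run through representatives of the arrows with source `x` modulo
this group, these are the entries of the matrix by which `f` acts on the free module spanned by
the arrows with source `x`. -/
noncomputable def entry {x y z : X} (f : SteinbergAlgebra R X) (σ : x ⟶ y) (τ : x ⟶ z) :
    MonoidAlgebra R (c.kerIsotropy x) :=
  .ofCoeff <| Finsupp.ofSupportFinite
    (fun k : c.kerIsotropy x => f ⟨z, y, Groupoid.inv τ ≫ (k.1 : x ⟶ x) ≫ σ⟩) <| by
    refine ((finite_support_fiber f y).preimage
      (f := fun k : c.kerIsotropy x =>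
        (⟨z, Groupoid.inv τ ≫ (k.1 : x ⟶ x) ≫ σ⟩ : Σ z : X, (z ⟶ y))) ?_).subset
      fun k hk => hk
    exact (conj_injective c σ τ).injOn

theorem entry_coeff {x y z : X} (f : SteinbergAlgebra R X) (σ : x ⟶ y) (τ : x ⟶ z)
    (k : c.kerIsotropy x) :
    (entry c f σ τ).coeff k = f ⟨z, y, Groupoid.inv τ ≫ (k.1 : x ⟶ x) ≫ σ⟩ := rfl

/-- The product of two entries is an entry of the convolution product, provided that only
arrows in `σ H τ⁻¹` contribute to the latter. -/
theorem entry_mul_entry {x y z w : X} (p q : SteinbergAlgebra R X)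
    (σ : x ⟶ y) (τ : x ⟶ z) (ρ : x ⟶ w) (k : c.kerIsotropy x)
    (H : ∀ (z' : X) (b : w ⟶ z') (a : z' ⟶ y), b ≫ a = Groupoid.inv ρ ≫ (k.1 : x ⟶ x) ≫ σ →
      p ⟨z', y, a⟩ ≠ 0 → q ⟨w, z', b⟩ ≠ 0 →
      ∃ j : c.kerIsotropy x,
        (⟨z, Groupoid.inv τ ≫ (j.1 : x ⟶ x) ≫ σ⟩ : Σ z, (z ⟶ y)) = ⟨z', a⟩) :
    (entry c p σ τ * entry c q τ ρ).coeff k =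
      (p * q) ⟨w, y, Groupoid.inv ρ ≫ (k.1 : x ⟶ x) ≫ σ⟩ := by
  rw [MonoidAlgebra.coeff_mul_apply_left, SteinbergAlgebra.mul_apply, conv_mk]
  let e : c.kerIsotropy x → Σ z : X, (z ⟶ y) :=
    fun j => ⟨z, Groupoid.inv τ ≫ (j.1 : x ⟶ x) ≫ σ⟩
  have he : Function.Injective e := conj_injective c σ τ
  rw [← finsum_mem_univ, ← finsum_mem_inter_support_eq _ (Set.range e) Set.univ,
    finsum_mem_range he, Finsupp.sum, finsum_eq_sum_of_support_subset]
  · refine Finset.sum_congr rfl fun j _ => ?_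
    rw [entry_coeff, entry_coeff]
    refine congrArg (fun t => _ * q ⟨w, z, t⟩) ?_
    change Groupoid.inv ρ ≫ ((k.1 : x ⟶ x) ≫ Groupoid.inv (j.1 : x ⟶ x)) ≫ τ = _
    simp [e, Groupoid.inv_eq_inv]
  · intro j hj
    exact Finsupp.mem_support_iff.2 (left_ne_zero_of_mul hj)
  · ext ⟨z', a⟩
    simp only [Set.mem_inter_iff, Set.mem_univ, true_and, and_iff_right_iff_imp]
    intro hne
    obtain ⟨j, hj⟩ := H z' _ a (by simp) (left_ne_zero_of_mul hne) (right_ne_zero_of_mul hne)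
    exact ⟨j, hj⟩

end Entry

/-! ### Homogeneous compact open bisections -/

section Bisection

variable {X : Type u} [Groupoid.{v} X] [TopologicalSpace (Arrows X)]
  {Γ : Type*} [Group Γ] [TopologicalSpace Γ]

/-- A compact open bisection on which the cocycle `c` has the constant value `g`. -/
structure IsHomogeneousBisection (c : Cocycle X Γ) (g : Γ) (B : Set (Arrows X)) : Prop where
  isCompact : IsCompact B
  isOpen : IsOpen B
  injOn_rng : B.InjOn rng
  injOn_src : B.InjOn src
  subset : B ⊆ c ⁻¹' {g}

variable [IsAmple X]

theorem continuous_rng : Continuous (rng : Arrows X → unitSpace X) :=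
  IsAmple.isLocalHomeomorph_rng.continuous

variable (X) in
theorem isOpen_unitSpace : IsOpen (unitSpace X) := by
  rw [isOpen_iff_mem_nhds]
  rintro _ ⟨x, rfl⟩
  obtain ⟨e, he, hr⟩ := IsAmple.isLocalHomeomorph_rng (unit x)
  have hcont : Continuous fun η : Arrows X => (rng η : Arrows X) :=
    continuous_subtype_val.comp continuous_rng
  filter_upwards [e.open_source.mem_nhds he,
    (e.open_source.preimage hcont).mem_nhds (show (rng (unit x) : Arrows X) ∈ e.source from he)]
    with η h1 h2
  -- Where the range map is injective, `η` and `r(η)` have the same range, hence coincide.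
  have h3 : (rng η : Arrows X) = η := e.injOn h2 h1 (by rw [← hr]; rfl)
  rw [← h3]
  exact (rng η).2

theorem IsHomogeneousBisection.image_inv {c : Cocycle X Γ} {g : Γ} {B : Set (Arrows X)}
    (h : IsHomogeneousBisection c g B) : IsHomogeneousBisection c g⁻¹ (inv ⁻¹' B) where
  isCompact := by
    rw [← (Function.Involutive.image_eq_preimage_symm inv_inv :
      Set.image (inv : Arrows X → Arrows X) = _)]
    exact h.isCompact.image IsAmple.continuous_inv
  isOpen := h.isOpen.preimage IsAmple.continuous_inv
  injOn_rng := fun η hη ζ hζ he => by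
    rw [← inv_inv η, ← inv_inv ζ]
    exact congrArg inv (h.injOn_src hη hζ he)
  injOn_src := fun η hη ζ hζ he => by
    rw [← inv_inv η, ← inv_inv ζ]
    exact congrArg inv (h.injOn_rng hη hζ he)
  subset := fun η hη => by
    have h1 : c (inv η) = g := h.subset hη
    rw [c.map_inv] at h1
    exact inv_eq_iff_eq_inv.1 h1

variable [T2Space (Arrows X)] [DiscreteTopology Γ]

/-- The homogeneous compact open bisections form a basis of the topology. -/
theorem exists_isHomogeneousBisection (c : Cocycle X Γ) {η : Arrows X} {O : Set (Arrows X)}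
    (hO : IsOpen O) (hη : η ∈ O) :
    ∃ B, IsHomogeneousBisection c (c η) B ∧ η ∈ B ∧ B ⊆ O := by
  obtain ⟨U, hU, hUc, hUo, hUr, hUs⟩ := exists_bisection η
  have hfib : IsClopen (c ⁻¹' {c η}) := (isClopen_discrete {c η}).preimage c.continuous_toFun
  obtain ⟨K, ⟨hKc, hKo⟩, hK, hKs⟩ :=
    (IsAmple.isTopologicalBasis (X := X)).exists_subset_of_mem_open
      (Set.mem_image_of_mem rng (Set.mem_inter hU hη))
      (IsAmple.isLocalHomeomorph_rng.isOpenMap _ (hUo.inter hO))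
  have hK' : IsClopen (rng ⁻¹' K : Set (Arrows X)) :=
    ⟨hKc.isClosed.preimage continuous_rng, hKo.preimage continuous_rng⟩
  refine ⟨U ∩ (rng ⁻¹' K ∩ c ⁻¹' {c η}), ⟨?_, hUo.inter (hK'.2.inter hfib.2),
    hUr.mono Set.inter_subset_left, hUs.mono Set.inter_subset_left, fun ζ hζ => hζ.2.2⟩,
    ⟨hU, hK, rfl⟩, ?_⟩
  · exact hUc.inter_right (hK'.1.inter hfib.1)
  · rintro ζ ⟨h1, h2, -⟩
    obtain ⟨ξ, hξ, hr⟩ := hKs h2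
    rw [← hUr hξ.1 h1 hr]
    exact hξ.2

end Bisection

/-! ### Characteristic functions -/

section CharFun

variable {X : Type u} [Groupoid.{v} X] [TopologicalSpace (Arrows X)]

theorem isOpen_support {R : Type w} [CommRing R] (f : SteinbergAlgebra R X) :
    IsOpen (Function.support f) :=
  (isClopen_support f.isLocallyConstant).2

variable [T2Space (Arrows X)]

/-- The characteristic function of a compact open set, as an element of the Steinberg algebra. -/
noncomputable def charFun (R : Type w) [CommRing R] {B : Set (Arrows X)} (hc : IsCompact B)
    (ho : IsOpen B) : SteinbergAlgebra R X :=
  ⟨B.indicator 1, by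
    have hl : IsLocallyConstant (B.indicator (1 : Arrows X → R)) := by
      rw [← LocallyConstant.coe_charFn R ⟨hc.isClosed, ho⟩]
      exact (LocallyConstant.charFn R _).isLocallyConstant
    exact ⟨hl, hc.of_isClosed_subset (isClopen_support hl).1 Set.support_indicator_subset⟩⟩

variable {R : Type w} [CommRing R]

theorem charFun_of_mem {B : Set (Arrows X)} (hc : IsCompact B) (ho : IsOpen B) {η : Arrows X}
    (h : η ∈ B) : charFun R hc ho η = 1 := Set.indicator_of_mem h _

theorem charFun_of_notMem {B : Set (Arrows X)} (hc : IsCompact B) (ho : IsOpen B) {η : Arrows X}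
    (h : η ∉ B) : charFun R hc ho η = 0 := Set.indicator_of_notMem h _

theorem mem_of_charFun_ne_zero {B : Set (Arrows X)} (hc : IsCompact B) (ho : IsOpen B)
    {η : Arrows X} (h : charFun R hc ho η ≠ 0) : η ∈ B := by
  by_contra h'
  exact h (charFun_of_notMem hc ho h')

theorem charFun_ne_zero_iff [Nontrivial R] {B : Set (Arrows X)} (hc : IsCompact B)
    (ho : IsOpen B) {η : Arrows X} : charFun R hc ho η ≠ 0 ↔ η ∈ B :=
  ⟨mem_of_charFun_ne_zero hc ho, fun h => by rw [charFun_of_mem hc ho h]; exact one_ne_zero⟩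

variable [IsAmple X] {Γ : Type*} [Group Γ] [TopologicalSpace Γ]

/-- Diagonal elements separate a unit from finitely many other units. -/
theorem exists_diagonal_separating (x : X) {F : Set X} (hF : F.Finite) :
    ∃ d ∈ diagonal R X, d (unit x) = 1 ∧ ∀ z ∈ F, z ≠ x → d (unit z) = 0 := by
  have hO : IsOpen (unitSpace X ∩ (unit '' (F \ {x}))ᶜ) :=
    (isOpen_unitSpace X).inter ((hF.subset Set.sdiff_subset).image unit).isClosed.isOpen_compl
  have hx : unit x ∈ unitSpace X ∩ (unit '' (F \ {x}))ᶜ := by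
    refine ⟨⟨x, rfl⟩, ?_⟩
    rintro ⟨z, hz, he⟩
    exact hz.2 (unit_injective he)
  let c : Cocycle X PUnit.{1} := ⟨fun _ => 1, continuous_const, fun _ => rfl⟩
  obtain ⟨B, hB, hxB, hBO⟩ := exists_isHomogeneousBisection c hO hx
  refine ⟨charFun R hB.isCompact hB.isOpen, fun η hη => (hBO ?_).1, charFun_of_mem _ _ hxB, ?_⟩
  · exact mem_of_charFun_ne_zero _ _ hη
  · intro z hz hne
    exact charFun_of_notMem _ _ fun h => (hBO h).2 ⟨z, ⟨hz, hne⟩, rfl⟩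

theorem isNormalizerPair_charFun {c : Cocycle X Γ} {g : Γ} {B : Set (Arrows X)}
    (hB : IsHomogeneousBisection c g B) :
    IsNormalizerPair c g (charFun R hB.isCompact hB.isOpen)
      (charFun R hB.image_inv.isCompact hB.image_inv.isOpen) := by
  -- All assertions come in pairs exchanged by `B ↦ B⁻¹`; this is one half of them.
  have key : ∀ {g g' : Γ} {B C : Set (Arrows X)} (hB : IsHomogeneousBisection c g B)
      (hC : IsHomogeneousBisection c g' C), (∀ η, η ∈ C ↔ inv η ∈ B) →
      charFun R hB.isCompact hB.isOpen ∈ homogeneous R c g ∧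
      (∀ d ∈ diagonal R X, charFun R hB.isCompact hB.isOpen * d *
        charFun R hC.isCompact hC.isOpen ∈ diagonal R X) ∧
      charFun R hB.isCompact hB.isOpen * charFun R hC.isCompact hC.isOpen ∈ diagonal R X ∧
      charFun R hB.isCompact hB.isOpen * charFun R hC.isCompact hC.isOpen *
        charFun R hB.isCompact hB.isOpen = charFun R hB.isCompact hB.isOpen := by
    intro g g' B C hB hC hBC
    have hdiag : ∀ {x y z : X} (a : y ⟶ z) (b : x ⟶ y), (⟨y, z, a⟩ : Arrows X) ∈ B →
        (⟨x, y, b⟩ : Arrows X) ∈ C → (⟨x, z, b ≫ a⟩ : Arrows X) ∈ unitSpace X := by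
      intro x y z a b ha hb
      have := hB.injOn_src ha ((hBC _).1 hb) rfl
      simp only [inv, Quiver.Total.mk.injEq, true_and] at this
      obtain ⟨rfl, h⟩ := this
      rw [eq_of_heq h, Groupoid.comp_inv]
      exact ⟨_, rfl⟩
    have hd : charFun R hB.isCompact hB.isOpen * charFun R hC.isCompact hC.isOpen ∈
        diagonal R X := by
      rintro ⟨x, y, h⟩ hne
      obtain ⟨z, b, a, rfl, h1, h2⟩ := SteinbergAlgebra.exists_of_mul_ne_zero hne
      exact hdiag a b (mem_of_charFun_ne_zero _ _ h1) (mem_of_charFun_ne_zero _ _ h2)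
    refine ⟨fun η hη => hB.subset (mem_of_charFun_ne_zero _ _ hη), ?_, hd, ?_⟩
    · rintro d hd ⟨x, y, h⟩ hne
      obtain ⟨z, b, a, rfl, h1, h2⟩ := SteinbergAlgebra.exists_of_mul_ne_zero hne
      rw [SteinbergAlgebra.mul_diagonal_apply _ hd] at h1
      exact hdiag a b (mem_of_charFun_ne_zero _ _ (left_ne_zero_of_mul h1))
        (mem_of_charFun_ne_zero _ _ h2)
    · ext ⟨x, y, h⟩
      rw [SteinbergAlgebra.diagonal_mul_apply hd]
      by_cases hm : (⟨x, y, h⟩ : Arrows X) ∈ B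
      · have hinj : Set.InjOn rng (Function.support (charFun R hB.isCompact hB.isOpen)) :=
          hB.injOn_rng.mono fun η hη => mem_of_charFun_ne_zero _ _ hη
        have h1 : (charFun R hB.isCompact hB.isOpen * charFun R hC.isCompact hC.isOpen)
            (unit y) = 1 := by
          have hm' : (⟨y, x, Groupoid.inv h⟩ : Arrows X) ∈ C := (hBC _).2 (by simpa [inv] using hm)
          rcases subsingleton_or_nontrivial R with hR | hR
          · exact Subsingleton.elim _ _
          · have := SteinbergAlgebra.mul_apply_comp hinj (charFun R hC.isCompact hC.isOpen)
              (Groupoid.inv h) h ((charFun_ne_zero_iff _ _).2 hm)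
            rw [Groupoid.inv_comp, charFun_of_mem _ _ hm, charFun_of_mem _ _ hm', one_mul] at this
            exact this
        rw [h1, one_mul]
      · rw [charFun_of_notMem _ _ hm, mul_zero]
  obtain ⟨h1, h2, h3, h4⟩ := key hB hB.image_inv fun η => Iff.rfl
  obtain ⟨h1', h2', h3', h4'⟩ := key hB.image_inv hB fun η => by
    rw [Set.mem_preimage, inv_inv]
  exact ⟨h1, h1', h4, h4', h3, h3', h2, h2'⟩

end CharFun

/-! ### Supports of normalizers are bisections -/

section Support

variable {R : Type w} [CommRing R] {X : Type u} [Groupoid.{v} X]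
  [TopologicalSpace (Arrows X)] [IsAmple X] [T2Space (Arrows X)] {Γ : Type*} [Group Γ]
  [TopologicalSpace Γ] {c : Cocycle X Γ} {g : Γ} {m n : SteinbergAlgebra R X}

namespace IsNormalizerPair

/-- If the group ring at `x` has no zero-divisors, the arrows with source `x` in the support of a
normalizer `m` have the same range: for distinct ranges `w ≠ v`, the product of the entries of
`m` in row `w` and of `n` in column `v` is an off-diagonal entry of `m d n` for a diagonal `d`. -/
theorem right_eq_of_left_eq (h : IsNormalizerPair c g m n) {x : X}
    (hx : NoZeroDivisors (MonoidAlgebra R (c.kerIsotropy x))) {v : X} {b : x ⟶ v}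
    (hb : n ⟨v, x, Groupoid.inv b⟩ ≠ 0) {w : X} {a : x ⟶ w} (ha : m ⟨x, w, a⟩ ≠ 0) :
    w = v := by
  by_contra hwv
  obtain ⟨d, hd, hdx, hdz⟩ := exists_diagonal_separating (R := R) x
    ((finite_support_fiber m w).image Sigma.fst)
  have hzero : entry c (m * d) a (𝟙 x) * entry c n (𝟙 x) b = 0 := by
    ext k
    rw [entry_mul_entry]
    · by_contra hne
      have := mk_mem_unitSpace_iff.1 (h.conj_mem d hd hne)
      simp only [Quiver.Total.mk.injEq] at this
      exact hwv this.2.1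
    · intro z' _ a' _ ha' _
      rw [SteinbergAlgebra.mul_diagonal_apply _ hd] at ha'
      have hm : m ⟨z', w, a'⟩ ≠ 0 := left_ne_zero_of_mul ha'
      obtain rfl : z' = x := by
        by_contra hz
        exact right_ne_zero_of_mul ha' (hdz z' ⟨⟨z', a'⟩, hm, rfl⟩ hz)
      refine ⟨⟨a' ≫ Groupoid.inv a, ?_⟩, ?_⟩
      · have h1 : c ⟨z', w, a'⟩ = g := h.left_mem hm
        have h2 : c ⟨z', w, a⟩ = g := h.left_mem ha
        rw [c.mem_kerIsotropy, c.map_hom_comp, c.map_hom_inv, h1, h2, inv_mul_cancel]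
      · simp
  rcases mul_eq_zero.1 hzero with h0 | h0
  · have h1 := congrArg (fun t => t.coeff 1) h0
    simp only [entry_coeff, MonoidAlgebra.coeff_zero, Finsupp.coe_zero, Pi.zero_apply,
      OneMemClass.coe_one, End.one_def, Category.id_comp,
      SteinbergAlgebra.mul_diagonal_apply _ hd, hdx, mul_one] at h1
    simp at h1
    exact ha h1
  · have h1 := congrArg (fun t => t.coeff 1) h0
    simp only [entry_coeff] at h1
    simp at h1
    exact hb (by simpa using h1)

variable [IsDomain R]

theorem exists_ne_zero (h : IsNormalizerPair c g m n) {x y : X} {a : x ⟶ y}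
    (ha : m ⟨x, y, a⟩ ≠ 0) :
    ∃ (z : X) (b : x ⟶ z), m ⟨x, z, b⟩ ≠ 0 ∧ n ⟨z, x, Groupoid.inv b⟩ ≠ 0 := by
  have h1 : (n * m) ⟨x, x, 𝟙 x⟩ ≠ 0 := by
    rw [show (n * m) ⟨x, x, 𝟙 x⟩ = 1 from h.mul_apply_unit ha]
    exact one_ne_zero
  obtain ⟨z, b, b', hb, hn, hm⟩ := SteinbergAlgebra.exists_of_mul_ne_zero h1
  obtain rfl : b' = Groupoid.inv b := by
    simpa using congrArg (Groupoid.inv b ≫ ·) hb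
  exact ⟨z, b, hm, hn⟩

/-- If the group ring at `x` has no zero-divisors and only trivial units, the support of a
normalizer contains at most one arrow with source `x`. -/
theorem eq_of_left_eq (h : IsNormalizerPair c g m n) {x : X}
    (hx : NoZeroDivisors (MonoidAlgebra R (c.kerIsotropy x)))
    (hu : OnlyTrivialUnits R (c.kerIsotropy x)) {y y' : X} {a : x ⟶ y} {a' : x ⟶ y'}
    (ha : m ⟨x, y, a⟩ ≠ 0) (ha' : m ⟨x, y', a'⟩ ≠ 0) :
    (⟨x, y, a⟩ : Arrows X) = ⟨x, y', a'⟩ := by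
  obtain ⟨v, b, hbm, hbn⟩ := h.exists_ne_zero ha
  have hmul : entry c n (𝟙 x) b * entry c m b (𝟙 x) = 1 := by
    ext k
    rw [entry_mul_entry]
    · by_cases hk : k = 1
      · subst hk
        have h1 := h.mul_apply_unit ha
        simpa [unit] using h1
      · rw [MonoidAlgebra.one_def, MonoidAlgebra.coeff_single,
          Finsupp.single_eq_of_ne hk]
        by_contra hne
        have h1 := mk_mem_unitSpace_iff.1 (h.mul_mem' hne)
        simp at h1
        exact hk (Subtype.ext h1)
    · intro z b₁ a₁ hba hn hm
      obtain rfl := h.right_eq_of_left_eq hx hbn hm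
      refine ⟨⟨b ≫ a₁, ?_⟩, by simp⟩
      have h1 : c ⟨z, x, a₁⟩ = g⁻¹ := h.right_mem hn
      have h2 : c ⟨x, z, b⟩ = g := h.left_mem hbm
      rw [c.mem_kerIsotropy, c.map_hom_comp, h1, h2, inv_mul_cancel]
  -- Without zero-divisors, the one-sided inverse is two-sided.
  have hmul' : entry c m b (𝟙 x) * entry c n (𝟙 x) b = 1 := by
    have hne : entry c m b (𝟙 x) ≠ 0 := fun h0 => by
      have := congrArg (fun t => t.coeff 1) h0
      simp [entry_coeff] at this
      exact hbm this
    have h0 : (entry c m b (𝟙 x) * entry c n (𝟙 x) b - 1) * entry c m b (𝟙 x) = 0 := by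
      rw [sub_mul, mul_assoc, hmul, mul_one, one_mul, sub_self]
    exact sub_eq_zero.1 ((mul_eq_zero.1 h0).resolve_right hne)
  obtain ⟨r, k, hrk⟩ := hu _ ⟨⟨_, _, hmul', hmul⟩, rfl⟩
  have hcoeff : ∀ j : c.kerIsotropy x, m ⟨x, v, (j.1 : x ⟶ x) ≫ b⟩ ≠ 0 → j = k := by
    intro j hj
    by_contra hne
    have h1 := congrArg (fun t => t.coeff j) hrk
    simp only [entry_coeff, MonoidAlgebra.coeff_single, Finsupp.single_eq_of_ne hne] at h1
    exact hj (by simpa using h1)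
  -- Every arrow of the support with source `x` is `b j` for some `j` in the group.
  have hall : ∀ {w : X} {e : x ⟶ w}, m ⟨x, w, e⟩ ≠ 0 →
      (⟨x, w, e⟩ : Arrows X) = ⟨x, v, (k.1 : x ⟶ x) ≫ b⟩ := by
    intro w e he
    obtain rfl := h.right_eq_of_left_eq hx hbn he
    have hj : e ≫ Groupoid.inv b ∈ c.kerIsotropy x := by
      have h1 : c ⟨x, w, e⟩ = g := h.left_mem he
      have h2 : c ⟨x, w, b⟩ = g := h.left_mem hbm
      rw [c.mem_kerIsotropy, c.map_hom_comp, c.map_hom_inv, h1, h2, inv_mul_cancel]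
    have := hcoeff ⟨_, hj⟩ (by simpa using he)
    rw [← this]
    simp
  rw [hall ha, hall ha']

/-- The support of a normalizer is an open set which contains at most one arrow with a given
source in a dense set of units; as the source map is open and the groupoid is Hausdorff, the
source map is injective on it. -/
theorem injOn_src (hc : IsotropyCondition R c) (h : IsNormalizerPair c g m n) :
    Set.InjOn src (Function.support m) := by
  intro η hη ζ hζ he
  by_contra hne
  obtain ⟨D, hD, hDx⟩ := hc
  obtain ⟨O, O', hO, hO', hηO, hζO, hdisj⟩ := t2_separation hne
  have hm := isOpen_support m
  have hopen := (IsAmple.isLocalHomeomorph_src (X := X)).isOpenMap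
  obtain ⟨_, ⟨⟨⟨x, y, a⟩, ha, rfl⟩, ⟨⟨x', y', a'⟩, ha', hx⟩⟩, hxD⟩ :=
    hD.inter_open_nonempty _ ((hopen _ (hm.inter hO)).inter (hopen _ (hm.inter hO')))
      ⟨src η, ⟨η, ⟨hη, hηO⟩, rfl⟩, ⟨ζ, ⟨hζ, hζO⟩, he.symm⟩⟩
  obtain rfl : x' = x := toUnitSpace_injective hx
  obtain ⟨h1, h2⟩ := hDx x' hxD
  have := h.eq_of_left_eq h1 h2 ha.1 ha'.1
  exact Set.disjoint_left.1 hdisj ha.2 (this ▸ ha'.2)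

theorem apply_inv_ne_zero (hc : IsotropyCondition R c) (h : IsNormalizerPair c g m n)
    {η : Arrows X} (hη : m η ≠ 0) : n (inv η) ≠ 0 := by
  obtain ⟨x, y, a⟩ := η
  obtain ⟨z, b, hbm, hbn⟩ := h.exists_ne_zero hη
  have := h.injOn_src hc hη hbm rfl
  rw [this]
  exact hbn

theorem injOn_rng (hc : IsotropyCondition R c) (h : IsNormalizerPair c g m n) :
    Set.InjOn rng (Function.support m) := by
  intro η hη ζ hζ he
  rw [← inv_inv η, ← inv_inv ζ]
  exact congrArg inv
    (h.symm.injOn_src hc (h.apply_inv_ne_zero hc hη) (h.apply_inv_ne_zero hc hζ) he)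

/-- An element whose support is contained in that of a normalizer `m` is a left multiple of `m`
by a diagonal element. -/
theorem exists_eq_diagonal_mul (hc : IsotropyCondition R c) (h : IsNormalizerPair c g m n)
    {f : SteinbergAlgebra R X} (hf : Function.support f ⊆ Function.support m) :
    ∃ d ∈ diagonal R X, f = d * m := by
  refine ⟨f * n, ?_, ?_⟩
  · rintro ⟨x, y, e⟩ hne
    obtain ⟨z, b, a, rfl, h1, h2⟩ := SteinbergAlgebra.exists_of_mul_ne_zero hne
    have := h.injOn_src hc (hf h1) (h.symm.apply_inv_ne_zero hc h2) rfl
    simp only [inv, Quiver.Total.mk.injEq, true_and] at this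
    obtain ⟨rfl, hab⟩ := this
    rw [eq_of_heq hab, Groupoid.comp_inv]
    exact ⟨_, rfl⟩
  · ext ⟨x, y, e⟩
    rw [mul_assoc, SteinbergAlgebra.mul_diagonal_apply f h.mul_mem']
    by_cases he : f ⟨x, y, e⟩ = 0
    · rw [he, zero_mul]
    · rw [h.mul_apply_unit (hf he), mul_one]

end IsNormalizerPair

end Support

/-! ### The correspondence of arrows given by a ring isomorphism -/

section Correspondence

variable {R : Type w} [CommRing R] {Γ : Type*} [Group Γ] [TopologicalSpace Γ]
  {X : Type*} [Groupoid X] [TopologicalSpace (Arrows X)] [IsAmple X] [T2Space (Arrows X)]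
  {Y : Type*} [Groupoid Y] [TopologicalSpace (Arrows Y)] [IsAmple Y] [T2Space (Arrows Y)]
  {c₁ : Cocycle X Γ} {c₂ : Cocycle Y Γ}

/-- A homogeneous element of the Steinberg algebra which normalizes the diagonal. -/
def IsNormalizer (c : Cocycle X Γ) (m : SteinbergAlgebra R X) : Prop :=
  ∃ g n, IsNormalizerPair c g m n

theorem IsNormalizer.mul {m m' : SteinbergAlgebra R X} (h : IsNormalizer c₁ m)
    (h' : IsNormalizer c₁ m') : IsNormalizer c₁ (m * m') := by
  obtain ⟨g, n, h⟩ := h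
  obtain ⟨g', n', h'⟩ := h'
  exact ⟨_, _, h.mul h'⟩

theorem exists_isNormalizer [Nontrivial R] [DiscreteTopology Γ] (c : Cocycle X Γ) {η : Arrows X}
    {O : Set (Arrows X)} (hO : IsOpen O) (hη : η ∈ O) :
    ∃ m : SteinbergAlgebra R X, m ∈ homogeneous R c (c η) ∧ IsNormalizer c m ∧ m η ≠ 0 ∧
      Function.support m ⊆ O := by
  obtain ⟨B, hB, hηB, hBO⟩ := exists_isHomogeneousBisection c hO hη
  have h := isNormalizerPair_charFun (R := R) hB
  exact ⟨_, h.left_mem, ⟨_, _, h⟩, (charFun_ne_zero_iff _ _).2 hηB,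
    fun ζ hζ => hBO (mem_of_charFun_ne_zero _ _ hζ)⟩

variable {φ : SteinbergAlgebra R X ≃+* SteinbergAlgebra R Y}

theorem IsDiagonalPreserving.symm (hd : IsDiagonalPreserving φ) :
    IsDiagonalPreserving φ.symm := by
  unfold IsDiagonalPreserving at *
  rw [← hd, Set.image_image]
  simp

theorem IsDiagonalPreserving.map_mem (hd : IsDiagonalPreserving φ) {f : SteinbergAlgebra R X}
    (hf : f ∈ diagonal R X) : φ f ∈ diagonal R Y :=
  hd.subset ⟨f, hf, rfl⟩

theorem IsGraded.symm (hg : IsGraded c₁ c₂ φ) : IsGraded c₂ c₁ φ.symm := by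
  intro g
  rw [← hg g, Set.image_image]
  simp

theorem IsGraded.map_mem (hg : IsGraded c₁ c₂ φ) {g : Γ} {f : SteinbergAlgebra R X}
    (hf : f ∈ homogeneous R c₁ g) : φ f ∈ homogeneous R c₂ g :=
  (hg g).subset ⟨f, hf, rfl⟩

theorem IsNormalizer.map (hd : IsDiagonalPreserving φ) (hg : IsGraded c₁ c₂ φ)
    {m : SteinbergAlgebra R X} (h : IsNormalizer c₁ m) : IsNormalizer c₂ (φ m) := by
  obtain ⟨g, n, h⟩ := h
  refine ⟨g, φ n, hg.map_mem h.left_mem, hg.map_mem h.right_mem, ?_, ?_, ?_, ?_, ?_, ?_⟩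
  · rw [← map_mul, ← map_mul, h.mul_mul_left]
  · rw [← map_mul, ← map_mul, h.mul_mul_right]
  · rw [← map_mul]
    exact hd.map_mem h.mul_mem
  · rw [← map_mul]
    exact hd.map_mem h.mul_mem'
  · intro d hd'
    have := hd.map_mem (h.conj_mem _ (hd.symm.map_mem hd'))
    simpa using this
  · intro d hd'
    have := hd.map_mem (h.conj_mem' _ (hd.symm.map_mem hd'))
    simpa using this

/-- The arrows `γ` and `δ` lie in the supports of the same normalizers, where the normalizers on
both sides are identified by means of `φ`. -/
def Corresponds (c₁ : Cocycle X Γ) (φ : SteinbergAlgebra R X ≃+* SteinbergAlgebra R Y)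
    (γ : Arrows X) (δ : Arrows Y) : Prop :=
  ∀ m : SteinbergAlgebra R X, IsNormalizer c₁ m → (m γ ≠ 0 ↔ φ m δ ≠ 0)

theorem Corresponds.symm (hd : IsDiagonalPreserving φ) (hg : IsGraded c₁ c₂ φ) {γ : Arrows X}
    {δ : Arrows Y} (h : Corresponds c₁ φ γ δ) : Corresponds c₂ φ.symm δ γ := by
  intro m hm
  have := h _ (hm.map hd.symm hg.symm)
  rw [RingEquiv.apply_symm_apply] at this
  exact this.symm

variable [IsDomain R]

theorem IsNormalizer.injOn_rng (hc : IsotropyCondition R c₁) {m : SteinbergAlgebra R X}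
    (h : IsNormalizer c₁ m) : Set.InjOn rng (Function.support m) := by
  obtain ⟨g, n, h⟩ := h
  exact h.injOn_rng hc

theorem IsNormalizer.injOn_src (hc : IsotropyCondition R c₁) {m : SteinbergAlgebra R X}
    (h : IsNormalizer c₁ m) : Set.InjOn src (Function.support m) := by
  obtain ⟨g, n, h⟩ := h
  exact h.injOn_src hc

/-- A diagonal-preserving isomorphism respects inclusions between the supports of normalizers. -/
theorem IsNormalizer.support_map_subset (hd : IsDiagonalPreserving φ)
    (hc : IsotropyCondition R c₁) {m f : SteinbergAlgebra R X} (h : IsNormalizer c₁ m)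
    (hf : Function.support f ⊆ Function.support m) :
    Function.support (φ f) ⊆ Function.support (φ m) := by
  obtain ⟨g, n, h⟩ := h
  obtain ⟨d, hd', rfl⟩ := h.exists_eq_diagonal_mul hc hf
  rintro ⟨x, y, a⟩ hη
  rw [map_mul, Function.mem_support,
    SteinbergAlgebra.diagonal_mul_apply (hd.map_mem hd')] at hη
  exact right_ne_zero_of_mul hη

variable [DiscreteTopology Γ]

theorem Corresponds.right_unique (hd : IsDiagonalPreserving φ) (hg : IsGraded c₁ c₂ φ)
    {γ : Arrows X} {δ δ' : Arrows Y} (h : Corresponds c₁ φ γ δ) (h' : Corresponds c₁ φ γ δ') :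
    δ = δ' := by
  by_contra hne
  obtain ⟨m, -, hm, hmδ, hmO⟩ := exists_isNormalizer (R := R) c₂
    (isClosed_singleton (x := δ')).isOpen_compl (show δ ∈ {δ'}ᶜ from hne)
  have hm' := hm.map hd.symm hg.symm
  have h1 := h _ hm'
  have h2 := h' _ hm'
  rw [RingEquiv.apply_symm_apply] at h1 h2
  exact hmO (h2.1 (h1.2 hmδ)) rfl

/-- The supports of the `φ(m)`, for the normalizers `m` with `m(γ) ≠ 0`, form a directed family
of nonempty compact sets; an arrow in their intersection corresponds to `γ`. -/
theorem exists_corresponds (hd : IsDiagonalPreserving φ) (hg : IsGraded c₁ c₂ φ)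
    (h₁ : IsotropyCondition R c₁) (h₂ : IsotropyCondition R c₂) (γ : Arrows X) :
    ∃ δ, Corresponds c₁ φ γ δ := by
  let I := {m : SteinbergAlgebra R X // IsNormalizer c₁ m ∧ m γ ≠ 0}
  have hI : Nonempty I := by
    obtain ⟨m, -, hm, hmγ, -⟩ :=
      exists_isNormalizer (R := R) c₁ isOpen_univ (Set.mem_univ γ)
    exact ⟨m, hm, hmγ⟩
  obtain ⟨δ, hδ⟩ := IsCompact.nonempty_iInter_of_directed_nonempty_isCompact_isClosed
    (fun m : I => Function.support (φ m.1)) (by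
      rintro ⟨m, hm, hmγ⟩ ⟨m', hm', hmγ'⟩
      obtain ⟨f, -, hf, hfγ, hfO⟩ := exists_isNormalizer (R := R) c₁
        ((isOpen_support m).inter (isOpen_support m')) ⟨hmγ, hmγ'⟩
      exact ⟨⟨f, hf, hfγ⟩,
        hm.support_map_subset hd h₁ fun ζ hζ => (hfO hζ).1,
        hm'.support_map_subset hd h₁ fun ζ hζ => (hfO hζ).2⟩) (by
      rintro ⟨m, hm, hmγ⟩
      by_contra hne
      have h0 : φ m = 0 := by
        ext ζ
        by_contra hζ
        exact hne ⟨ζ, hζ⟩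
      rw [map_eq_zero_iff φ φ.injective] at h0
      exact hmγ (by rw [h0]; rfl))
    (fun m => (φ m.1).isCompact_support) (fun m => (φ m.1).isCompact_support.isClosed)
  rw [Set.mem_iInter] at hδ
  refine ⟨δ, fun m hm => ⟨fun h => hδ ⟨m, hm, h⟩, fun h => ?_⟩⟩
  by_contra hmγ
  -- A normalizer supported near `γ`, away from the support of `m`.
  obtain ⟨f, -, hf, hfγ, hfO⟩ := exists_isNormalizer (R := R) c₁
    m.isCompact_support.isClosed.isOpen_compl (Function.notMem_support.2 hmγ)
  obtain ⟨k, -, hk, hkδ, hkO⟩ := exists_isNormalizer (R := R) c₂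
    ((isOpen_support (φ m)).inter (isOpen_support (φ f))) ⟨h, hδ ⟨f, hf, hfγ⟩⟩
  have h1 := (hm.map hd hg).support_map_subset hd.symm h₂ fun ζ hζ => (hkO hζ).1
  have h2 := (hf.map hd hg).support_map_subset hd.symm h₂ fun ζ hζ => (hkO hζ).2
  rw [RingEquiv.symm_apply_apply] at h1 h2
  have h0 : φ.symm k = 0 := by
    ext ζ
    by_contra hζ
    exact hfO (h2 hζ) (h1 hζ)
  rw [map_eq_zero_iff φ.symm φ.symm.injective] at h0
  exact hkδ (by rw [h0]; rfl)

/-- The correspondence of arrows is multiplicative, as the support of the product of two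
normalizers is the product of their supports. -/
theorem Corresponds.mul (hd : IsDiagonalPreserving φ) (hg : IsGraded c₁ c₂ φ)
    (h₁ : IsotropyCondition R c₁) (h₂ : IsotropyCondition R c₂)
    {p : ComposablePairs X} {δ₁ δ₂ δ : Arrows Y} (hδ₁ : Corresponds c₁ φ p.1.1 δ₁)
    (hδ₂ : Corresponds c₁ φ p.1.2 δ₂) (hδ : Corresponds c₁ φ (comp p) δ) :
    ∃ q : ComposablePairs Y, q.1 = (δ₁, δ₂) ∧ δ = comp q := by
  have key : ∀ m₁ m₂ : SteinbergAlgebra R Y, IsNormalizer c₂ m₁ → IsNormalizer c₂ m₂ →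
      m₁ δ₁ ≠ 0 → m₂ δ₂ ≠ 0 →
      ∃ q : ComposablePairs Y, comp q = δ ∧ m₁ q.1.1 ≠ 0 ∧ m₂ q.1.2 ≠ 0 := by
    intro m₁ m₂ hm₁ hm₂ h1 h2
    have hn₁ := hm₁.map hd.symm hg.symm
    have hn₂ := hm₂.map hd.symm hg.symm
    rw [← φ.apply_symm_apply m₁, ← hδ₁ _ hn₁] at h1
    rw [← φ.apply_symm_apply m₂, ← hδ₂ _ hn₂] at h2
    have h3 : (φ.symm m₁ * φ.symm m₂) (comp p) ≠ 0 := by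
      obtain ⟨⟨⟨y, z, a⟩, ⟨x, y', b⟩⟩, hp⟩ := p
      obtain rfl : y = y' := toUnitSpace_injective hp
      have h4 : comp ⟨(⟨y, z, a⟩, ⟨x, y, b⟩), hp⟩ = ⟨x, z, b ≫ a⟩ := comp_mkPair a b
      rw [h4, SteinbergAlgebra.mul_apply_comp (hn₁.injOn_rng h₁) _ b a h1]
      exact mul_ne_zero h1 h2
    rw [hδ _ (hn₁.mul hn₂), map_mul, φ.apply_symm_apply, φ.apply_symm_apply] at h3
    exact conv_ne_zero h3
  obtain ⟨m₁, -, hm₁, hmδ₁, -⟩ :=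
    exists_isNormalizer (R := R) c₂ isOpen_univ (Set.mem_univ δ₁)
  obtain ⟨m₂, -, hm₂, hmδ₂, -⟩ :=
    exists_isNormalizer (R := R) c₂ isOpen_univ (Set.mem_univ δ₂)
  obtain ⟨q, hq, hq₁, hq₂⟩ := key m₁ m₂ hm₁ hm₂ hmδ₁ hmδ₂
  refine ⟨q, ?_, hq.symm⟩
  -- Shrinking the supports of `m₁` and `m₂` does not change the factorisation of `δ`, since
  -- its range and source are fixed.
  have hq1 : q.1.1 = δ₁ := by
    by_contra hne
    obtain ⟨m, -, hm, hmδ, hmO⟩ := exists_isNormalizer (R := R) c₂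
      ((isOpen_support m₁).inter (isClosed_singleton (x := q.1.1)).isOpen_compl)
      ⟨hmδ₁, show δ₁ ∈ {q.1.1}ᶜ from fun h => hne h.symm⟩
    obtain ⟨q', hq', hq₁', -⟩ := key m m₂ hm hm₂ hmδ hmδ₂
    have hr : rng q'.1.1 = rng q.1.1 := by
      change rng (comp q') = rng (comp q)
      rw [hq, hq']
    exact (hmO hq₁').2 (hm₁.injOn_rng h₂ (hmO hq₁').1 hq₁ hr)
  have hq2 : q.1.2 = δ₂ := by
    by_contra hne
    obtain ⟨m, -, hm, hmδ, hmO⟩ := exists_isNormalizer (R := R) c₂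
      ((isOpen_support m₂).inter (isClosed_singleton (x := q.1.2)).isOpen_compl)
      ⟨hmδ₂, show δ₂ ∈ {q.1.2}ᶜ from fun h => hne h.symm⟩
    obtain ⟨q', hq', -, hq₂'⟩ := key m₁ m hm₁ hm hmδ₁ hmδ
    have hr : src q'.1.2 = src q.1.2 := by
      change src (comp q') = src (comp q)
      rw [hq, hq']
    exact (hmO hq₂').2 (hm₂.injOn_src h₂ (hmO hq₂').1 hq₂ hr)
  exact Prod.ext hq1 hq2

theorem continuous_of_corresponds (hd : IsDiagonalPreserving φ) (hg : IsGraded c₁ c₂ φ)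
    {ψ : Arrows X → Arrows Y} (hψ : ∀ γ, Corresponds c₁ φ γ (ψ γ)) : Continuous ψ := by
  rw [continuous_iff_continuousAt]
  intro γ O hO
  obtain ⟨O', hO', hO'o, hγ⟩ := mem_nhds_iff.1 hO
  obtain ⟨m, -, hm, hmγ, hmO⟩ := exists_isNormalizer (R := R) c₂ hO'o hγ
  have h : ∀ ζ : Arrows X, φ.symm m ζ ≠ 0 ↔ m (ψ ζ) ≠ 0 := fun ζ => by
    rw [hψ ζ _ (hm.map hd.symm hg.symm), φ.apply_symm_apply]
  exact Filter.mem_map.2 <| Filter.mem_of_superset ((isOpen_support _).mem_nhds ((h γ).2 hmγ))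
    fun ζ hζ => hO' (hmO ((h ζ).1 hζ))

end Correspondence

/-! ### Isomorphisms of groupoids -/

section GroupoidIso

variable {X : Type*} [Groupoid X] {Y : Type*} [Groupoid Y]

/-- The composable pair `(η, s(η))`. -/
def srcPair (η : Arrows X) : ComposablePairs X := ⟨(η, src η), rfl⟩

/-- The composable pair `(r(η), η)`. -/
def rngPair (η : Arrows X) : ComposablePairs X := ⟨(rng η, η), rfl⟩

theorem comp_srcPair (η : Arrows X) : comp (srcPair η) = η := by
  obtain ⟨x, y, a⟩ := η
  exact (comp_mkPair a (𝟙 x)).trans (by rw [Category.id_comp])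

/-- An idempotent arrow is a unit. -/
theorem mem_unitSpace_of_comp_self {p : ComposablePairs X} (h : p.1.1 = p.1.2)
    (hp : comp p = p.1.1) : p.1.1 ∈ unitSpace X := by
  obtain ⟨⟨⟨x, y, a⟩, η⟩, he⟩ := p
  obtain rfl : (⟨x, y, a⟩ : Arrows X) = η := h
  obtain rfl : x = y := toUnitSpace_injective he
  have h1 : (⟨x, x, a ≫ a⟩ : Arrows X) = ⟨x, x, a⟩ := (comp_mkPair a a).symm.trans hp
  simp only [Quiver.Total.mk.injEq, heq_eq_eq, true_and] at h1
  have h2 : a = 𝟙 x := by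
    simpa using congrArg (· ≫ Groupoid.inv a) h1
  exact ⟨x, by rw [h2]; rfl⟩

theorem eq_src_of_mem_unitSpace {η : Arrows X} (h : η ∈ unitSpace X) : η = src η := by
  obtain ⟨x, rfl⟩ := h
  rfl

theorem eq_rng_of_mem_unitSpace {η : Arrows X} (h : η ∈ unitSpace X) : η = rng η := by
  obtain ⟨x, rfl⟩ := h
  rfl

variable [TopologicalSpace (Arrows X)] [TopologicalSpace (Arrows Y)]

/-- A homeomorphism which preserves products is an isomorphism of topological groupoids. -/
def GroupoidIso.ofMapComp (ψ : Arrows X ≃ₜ Arrows Y)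
    (h : ∀ p : ComposablePairs X, ∃ q : ComposablePairs Y,
      q.1 = (ψ p.1.1, ψ p.1.2) ∧ ψ (comp p) = comp q) : GroupoidIso X Y :=
  have hunit : ∀ α ∈ unitSpace X, ψ α ∈ unitSpace Y := by
    rintro _ ⟨x, rfl⟩
    obtain ⟨q, hq, hq'⟩ := h (srcPair (unit x))
    have h1 : q.1.1 = ψ (unit x) := congrArg Prod.fst hq
    have h2 : q.1.2 = ψ (unit x) := congrArg Prod.snd hq
    rw [comp_srcPair] at hq'
    rw [← h1]
    exact mem_unitSpace_of_comp_self (h1.trans h2.symm) (hq'.symm.trans h1.symm)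
  { ψ with
    map_unit := hunit
    map_rng := fun α => by
      obtain ⟨q, hq, -⟩ := h (rngPair α)
      have h1 : q.1.1 = ψ (rng α) := congrArg Prod.fst hq
      have h2 : q.1.2 = ψ α := congrArg Prod.snd hq
      have h3 := q.2
      rw [h1, h2] at h3
      exact (eq_src_of_mem_unitSpace (hunit _ (rng α).2)).trans (congrArg Subtype.val h3)
    map_src := fun α => by
      obtain ⟨q, hq, -⟩ := h (srcPair α)
      have h1 : q.1.1 = ψ α := congrArg Prod.fst hq
      have h2 : q.1.2 = ψ (src α) := congrArg Prod.snd hq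
      have h3 := q.2
      rw [h1, h2] at h3
      exact (eq_rng_of_mem_unitSpace (hunit _ (src α).2)).trans (congrArg Subtype.val h3.symm)
    map_comp := h }

end GroupoidIso

/-! ### Reconstruction of the groupoid -/

section Reconstruction

variable {R : Type w} [CommRing R] [IsDomain R] {Γ : Type*} [Group Γ] [TopologicalSpace Γ]
  [DiscreteTopology Γ]
  {X : Type*} [Groupoid X] [TopologicalSpace (Arrows X)] [IsAmple X] [T2Space (Arrows X)]
  {Y : Type*} [Groupoid Y] [TopologicalSpace (Arrows Y)] [IsAmple Y] [T2Space (Arrows Y)]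
  {c₁ : Cocycle X Γ} {c₂ : Cocycle Y Γ}

/-- A diagonal-preserving graded ring isomorphism of Steinberg algebras gives an isomorphism of
the groupoids which respects the cocycles. -/
theorem exists_groupoidIso_of_ringEquiv {φ : SteinbergAlgebra R X ≃+* SteinbergAlgebra R Y}
    (hd : IsDiagonalPreserving φ) (hg : IsGraded c₁ c₂ φ)
    (h₁ : IsotropyCondition R c₁) (h₂ : IsotropyCondition R c₂) :
    ∃ ψ : GroupoidIso X Y, ∀ α, c₂ (ψ.toHomeomorph α) = c₁ α := by
  choose ψ hψ using exists_corresponds hd hg h₁ h₂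
  choose ψ' hψ' using exists_corresponds hd.symm hg.symm h₂ h₁
  let e : Arrows X ≃ₜ Arrows Y :=
    { toFun := ψ
      invFun := ψ'
      left_inv := fun γ => (hψ' (ψ γ)).right_unique hd.symm hg.symm ((hψ γ).symm hd hg)
      right_inv := fun δ =>
        (hψ (ψ' δ)).right_unique hd hg ((hψ' δ).symm hd.symm hg.symm)
      continuous_toFun := continuous_of_corresponds hd hg hψ
      continuous_invFun := continuous_of_corresponds hd.symm hg.symm hψ' }
  refine ⟨.ofMapComp e fun p => (hψ p.1.1).mul hd hg h₁ h₂ (hψ p.1.2) (hψ (comp p)),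
    fun α => ?_⟩
  obtain ⟨m, hmh, hm, hmα, -⟩ :=
    exists_isNormalizer (R := R) c₁ isOpen_univ (Set.mem_univ α)
  exact hg.map_mem hmh ((hψ α m hm).1 hmα)

end Reconstruction

/-! ### The isomorphism of Steinberg algebras given by an isomorphism of groupoids -/

namespace GroupoidIso

variable {X : Type*} [Groupoid X] [TopologicalSpace (Arrows X)]
  {Y : Type*} [Groupoid Y] [TopologicalSpace (Arrows Y)] (ψ : GroupoidIso X Y)

theorem apply_inv (η : Arrows X) : ψ.toHomeomorph (inv η) = inv (ψ.toHomeomorph η) := by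
  have h : ∀ q : ComposablePairs Y, comp q = rng q.1.1 → q.1.2 = inv q.1.1 := by
    rintro ⟨⟨⟨y, z, a⟩, ⟨x, y', b⟩⟩, hq⟩ h
    obtain rfl : y = y' := toUnitSpace_injective hq
    have h1 : (⟨x, z, b ≫ a⟩ : Arrows Y) = ⟨z, z, 𝟙 z⟩ := (comp_mkPair a b).symm.trans h
    simp only [Quiver.Total.mk.injEq, true_and] at h1
    obtain ⟨rfl, h1⟩ := h1
    have h2 : b = Groupoid.inv a := by
      simpa using congrArg (· ≫ Groupoid.inv a) (eq_of_heq h1)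
    rw [h2]
    rfl
  obtain ⟨q, hq, hq'⟩ := ψ.map_comp ⟨(η, inv η), rfl⟩
  have h1 : q.1.1 = ψ.toHomeomorph η := congrArg Prod.fst hq
  have h2 : q.1.2 = ψ.toHomeomorph (inv η) := congrArg Prod.snd hq
  have h3 : comp ⟨(η, inv η), rfl⟩ = (rng η : Arrows X) := by
    obtain ⟨x, y, a⟩ := η
    refine (comp_mkPair a (Groupoid.inv a)).trans ?_
    rw [Groupoid.inv_comp]
    rfl
  rw [← h1, ← h2]
  refine h q ?_
  rw [← hq', h3, h1]
  exact ψ.map_rng η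

theorem apply_mem_unitSpace_iff (η : Arrows X) :
    ψ.toHomeomorph η ∈ unitSpace Y ↔ η ∈ unitSpace X := by
  refine ⟨fun h => ?_, ψ.map_unit η⟩
  have h1 : ψ.toHomeomorph η = ψ.toHomeomorph (src η) :=
    (eq_src_of_mem_unitSpace h).trans (ψ.map_src η).symm
  rw [ψ.toHomeomorph.injective h1]
  exact (src η).2

theorem conv_apply {R : Type*} [CommRing R] (f g : Arrows Y → R) (η : Arrows X) :
    conv (f ∘ ψ.toHomeomorph) (g ∘ ψ.toHomeomorph) η = conv f g (ψ.toHomeomorph η) := by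
  have h : ∀ p : ComposablePairs X,
      src (ψ.toHomeomorph p.1.1) = rng (ψ.toHomeomorph p.1.2) := fun p => by
    refine Subtype.ext ((ψ.map_src _).symm.trans (Eq.trans ?_ (ψ.map_rng _)))
    rw [p.2]
  have h' : ∀ p : ComposablePairs X, comp ⟨(ψ.toHomeomorph p.1.1, ψ.toHomeomorph p.1.2), h p⟩ =
      ψ.toHomeomorph (comp p) := fun p => by
    obtain ⟨q, hq, hq'⟩ := ψ.map_comp p
    refine Eq.trans (congrArg comp (Subtype.ext ?_)) hq'.symm
    exact hq.symm
  refine finsum_eq_of_bijective (fun p => ⟨⟨_, h p.1⟩, by rw [h', p.2]⟩) ⟨?_, ?_⟩ fun p => rfl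
  · rintro ⟨p, hp⟩ ⟨p', hp'⟩ he
    have he := congrArg (fun q => q.1.1) he
    exact Subtype.ext (Subtype.ext (Prod.ext (ψ.toHomeomorph.injective (congrArg Prod.fst he))
      (ψ.toHomeomorph.injective (congrArg Prod.snd he))))
  · rintro ⟨q, hq⟩
    obtain ⟨⟨a, b⟩, hab⟩ := q
    obtain ⟨a, rfl⟩ := ψ.toHomeomorph.surjective a
    obtain ⟨b, rfl⟩ := ψ.toHomeomorph.surjective b
    have hc : src a = rng b := by
      refine Subtype.ext (ψ.toHomeomorph.injective ?_)
      exact (ψ.map_src a).trans ((congrArg Subtype.val hab).trans (ψ.map_rng b).symm)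
    refine ⟨⟨⟨(a, b), hc⟩, ψ.toHomeomorph.injective ?_⟩, rfl⟩
    rw [← h', ← hq]

/-- Transport of elements of the Steinberg algebra along a homeomorphism. -/
def transport (R : Type*) [CommRing R] (e : Arrows X ≃ₜ Arrows Y) (f : SteinbergAlgebra R X) :
    SteinbergAlgebra R Y :=
  ⟨f ∘ e.symm, f.isLocallyConstant.comp_continuous e.symm.continuous, by
    have : Function.support (f ∘ e.symm) = e '' Function.support f := by
      rw [e.image_eq_preimage_symm]
      rfl
    rw [this]
    exact f.isCompact_support.image e.continuous⟩

/-- The `*`-algebra isomorphism `f ↦ f ∘ ψ⁻¹`. -/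
def starAlgEquiv (R : Type*) [CommRing R] [StarRing R] [IsAmple X] [T2Space (Arrows X)]
    [IsAmple Y] [T2Space (Arrows Y)] : SteinbergAlgebra R X ≃⋆ₐ[R] SteinbergAlgebra R Y where
  toFun := transport R ψ.toHomeomorph
  invFun := transport R ψ.toHomeomorph.symm
  left_inv f := SteinbergAlgebra.ext fun η => congrArg f (ψ.toHomeomorph.symm_apply_apply η)
  right_inv f := SteinbergAlgebra.ext fun η => congrArg f (ψ.toHomeomorph.apply_symm_apply η)
  map_mul' f g := SteinbergAlgebra.ext fun η => by
    obtain ⟨η, rfl⟩ := ψ.toHomeomorph.surjective η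
    have h := ψ.conv_apply (transport R ψ.toHomeomorph f) (transport R ψ.toHomeomorph g) η
    have hf : ∀ f : SteinbergAlgebra R X,
        (transport R ψ.toHomeomorph f : Arrows Y → R) ∘ ψ.toHomeomorph = f := fun f =>
      funext fun η => congrArg f (ψ.toHomeomorph.symm_apply_apply η)
    rw [hf, hf] at h
    exact (congrArg (f * g) (ψ.toHomeomorph.symm_apply_apply η)).trans h
  map_add' f g := rfl
  map_star' f := SteinbergAlgebra.ext fun η => by
    obtain ⟨η, rfl⟩ := ψ.toHomeomorph.surjective η
    change star (f (inv (ψ.toHomeomorph.symm (ψ.toHomeomorph η)))) =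
      star (f (ψ.toHomeomorph.symm (inv (ψ.toHomeomorph η))))
    rw [← ψ.apply_inv, Homeomorph.symm_apply_apply, Homeomorph.symm_apply_apply]
  map_smul' r f := rfl

theorem starAlgEquiv_apply_apply {R : Type*} [CommRing R] [StarRing R] [IsAmple X]
    [T2Space (Arrows X)] [IsAmple Y] [T2Space (Arrows Y)] (f : SteinbergAlgebra R X)
    (η : Arrows X) : ψ.starAlgEquiv R f (ψ.toHomeomorph η) = f η :=
  congrArg f (ψ.toHomeomorph.symm_apply_apply η)

/-- Restricting supports to corresponding sets of arrows gives corresponding subsets of the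
Steinberg algebras. -/
theorem image_starAlgEquiv {R : Type*} [CommRing R] [StarRing R] [IsAmple X]
    [T2Space (Arrows X)] [IsAmple Y] [T2Space (Arrows Y)] {S : Set (Arrows X)}
    {T : Set (Arrows Y)} (h : ∀ η, ψ.toHomeomorph η ∈ T ↔ η ∈ S) :
    ψ.starAlgEquiv R '' {f : SteinbergAlgebra R X | Function.support f ⊆ S} =
      {f : SteinbergAlgebra R Y | Function.support f ⊆ T} := by
  have hiff : ∀ f : SteinbergAlgebra R X,
      Function.support (ψ.starAlgEquiv R f) ⊆ T ↔ Function.support f ⊆ S := by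
    intro f
    constructor
    · intro hf η hη
      rw [← h]
      refine hf ?_
      rwa [Function.mem_support, starAlgEquiv_apply_apply]
    · intro hf η hη
      obtain ⟨η, rfl⟩ := ψ.toHomeomorph.surjective η
      rw [Function.mem_support, starAlgEquiv_apply_apply] at hη
      exact (h η).2 (hf hη)
  ext f
  constructor
  · rintro ⟨f, hf, rfl⟩
    exact (hiff f).2 hf
  · intro hf
    obtain ⟨f, rfl⟩ := (ψ.starAlgEquiv R).surjective f
    exact ⟨f, (hiff f).1 hf, rfl⟩

end GroupoidIso

end SteinbergAlg

theorem mainTheorem1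
    {R : Type*} [CommRing R] [IsDomain R] [StarRing R]
    {Γ : Type*} [Group Γ] [TopologicalSpace Γ] [DiscreteTopology Γ]
    {X₁ : Type*} [CategoryTheory.Groupoid X₁] [TopologicalSpace (SteinbergAlg.Arrows X₁)]
    [T2Space (SteinbergAlg.Arrows X₁)] [SteinbergAlg.IsAmple X₁]
    {X₂ : Type*} [CategoryTheory.Groupoid X₂] [TopologicalSpace (SteinbergAlg.Arrows X₂)]
    [T2Space (SteinbergAlg.Arrows X₂)] [SteinbergAlg.IsAmple X₂]
    (c₁ : SteinbergAlg.Cocycle X₁ Γ) (c₂ : SteinbergAlg.Cocycle X₂ Γ)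
    (h₁ : SteinbergAlg.IsotropyCondition R c₁) (h₂ : SteinbergAlg.IsotropyCondition R c₂) :
    List.TFAE
      [∃ ψ : SteinbergAlg.GroupoidIso X₁ X₂, ∀ α, c₂ (ψ.toHomeomorph α) = c₁ α,
       ∃ φ : SteinbergAlg.SteinbergAlgebra R X₁ ≃⋆ₐ[R] SteinbergAlg.SteinbergAlgebra R X₂,
         SteinbergAlg.IsDiagonalPreserving φ ∧ SteinbergAlg.IsGraded c₁ c₂ φ,
       ∃ φ : SteinbergAlg.SteinbergAlgebra R X₁ ≃+* SteinbergAlg.SteinbergAlgebra R X₂,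
         SteinbergAlg.IsDiagonalPreserving φ ∧ SteinbergAlg.IsGraded c₁ c₂ φ] := by
  tfae_have 1 → 2 := by
    rintro ⟨ψ, hψ⟩
    refine ⟨ψ.starAlgEquiv R, ψ.image_starAlgEquiv ψ.apply_mem_unitSpace_iff, fun g =>
      ψ.image_starAlgEquiv fun η => ?_⟩
    rw [Set.mem_preimage, Set.mem_preimage, hψ]
  tfae_have 2 → 3 := by
    rintro ⟨φ, hd, hg⟩
    exact ⟨φ.toRingEquiv, hd, hg⟩
  tfae_have 3 → 1 := by
    rintro ⟨φ, hd, hg⟩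
    exact SteinbergAlg.exists_groupoidIso_of_ringEquiv hd hg h₁ h₂
  tfae_finish
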